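/- For $\epsilon>0$ and $t\in\mathbb R$ let $U_\epsilon(t)=e^{it\varphi_\epsilon(D)}$ be the Fourier multiplier on $\mathbb R^2$ with symbol $e^{it\varphi_\epsilon(\xi)}$, where $\varphi_\epsilon(\xi)=\epsilon|\xi|^3-|\xi|$, and let $D^\beta$ be the Fourier multiplier with symbol $|\xi|^\beta$ (both acting on tempered distributions whose Fourier transform is a function, with the frequency $\xi$ normalized so that $\partial_j$ has symbol $i\xi_j$). For every $\theta>0$ there is a constant $C>0$, depending only on $\theta$, such that for all $0<\epsilon\le 1$, all $0\le\beta\le 1$, all real $t\neq 0$ and all $u_0\in L^1(\mathbb R^2)$, the tempered distribution $D^\beta U_\epsilon(t)u_0$ is a function in $L^\infty(\mathbb R^2)$ and $$\|D^\beta U_\epsilon(t)u_0\|_{L^\infty(\mathbb R^2)}\le C\,k_{\beta,\epsilon}(t)\,\|u_0\|_{L^1(\mathbb R^2)},$$ where $$k_{\beta,\epsilon}(t)=\begin{cases}(\epsilon|t|)^{-\frac{2+\beta}{3}} & \text{if } |t|\le\theta\epsilon^{1/2},\\[2pt] \epsilon^{-\frac34-\frac\beta2}\,|t|^{-\frac12}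 & \text{if } |t|\ge\theta\epsilon^{1/2}\end{cases}$$ (when $|t|=\theta\epsilon^{1/2}$ the bound holds with either of the two expressions). -/

import Mathlib

open MeasureTheory
open scoped SchwartzMap FourierTransform ENNReal

namespace KdVDispersive

/-- The Euclidean plane `ℝ²`. -/
abbrev Plane : Type := EuclideanSpace ℝ (Fin 2)

/-- The tempered distribution `T` is the function `a`, that is
`T φ = ∫ φ(x) a(x) dx` (an absolutely convergent integral) for all Schwartz functions `φ`. -/
def IsFunction (T : 𝓢'(Plane, ℂ)) (a : Plane → ℂ) : Prop :=
  ∀ φ : 𝓢(Plane, ℂ), Integrable (fun x => φ x * a x) ∧ T φ = ∫ x, φ x * a x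

/-- `v = m(D) u`: the Fourier transform of `u` is a function `a`, and the Fourier transform
of `v` is the product of the symbol `m` and this function.

The frequency variable `ξ` of the symbol is the one of the transform with kernel `e^{-i x·ξ}`
(so that `∂_j` has symbol `i ξ_j`), whereas Mathlib's transform `𝓕` has kernel
`e^{-2π i x·η}`; hence `ξ = 2π η`. The operator `m(D)` does not depend on the constant in
front of the Fourier integral. -/
def IsFourierMultiplier (m : Plane → ℂ) (u v : 𝓢'(Plane, ℂ)) : Prop :=
  ∃ a : Plane → ℂ, IsFunction (𝓕 u) a ∧
    IsFunction (𝓕 v) (fun η => m ((2 * Real.pi) • η) * a η)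

theorem IsFunction.locallyIntegrable {T : 𝓢'(Plane, ℂ)} {a : Plane → ℂ} (ha : IsFunction T a) :
    LocallyIntegrable a volume := by
  rw [locallyIntegrable_iff]
  intro K hK
  obtain ⟨R, hR⟩ := hK.isBounded.subset_closedBall (0 : Plane)
  let f : ContDiffBump (0 : Plane) := ⟨|R| + 1, |R| + 2, by positivity, by linarith⟩
  have h₁ : HasCompactSupport (Complex.ofRealCLM ∘ f) := f.hasCompactSupport.comp_left rfl
  have h₂ : ContDiff ℝ ((⊤ : ℕ∞) : WithTop ℕ∞) (Complex.ofRealCLM ∘ f) :=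
    Complex.ofRealCLM.contDiff.comp f.contDiff
  have h := ((ha (h₁.toSchwartzMap h₂)).1.integrableOn (s := K))
  refine h.congr_fun (fun x hx => ?_) hK.measurableSet
  have hx1 : f x = 1 := f.one_of_mem_closedBall
    (Metric.closedBall_subset_closedBall (by
      show R ≤ |R| + 1
      linarith [le_abs_self R]) (hR hx))
  simp [hx1]

theorem IsFunction.ae_unique {T : 𝓢'(Plane, ℂ)} {a b : Plane → ℂ}
    (ha : IsFunction T a) (hb : IsFunction T b) : a =ᵐ[volume] b := by
  refine ae_eq_of_integral_contDiff_smul_eq ha.locallyIntegrable hb.locallyIntegrable ?_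
  intro g hg hc
  have h₁ : HasCompactSupport (Complex.ofRealCLM ∘ g) := hc.comp_left rfl
  have h₂ : ContDiff ℝ ((⊤ : ℕ∞) : WithTop ℕ∞) (Complex.ofRealCLM ∘ g) :=
    Complex.ofRealCLM.contDiff.comp hg
  have h := (ha (h₁.toSchwartzMap h₂)).2.symm.trans (hb (h₁.toSchwartzMap h₂)).2
  simpa using h

/-- The relation `v = m(D) u` determines `v` from `u`. -/
theorem IsFourierMultiplier.unique {m : Plane → ℂ} {u v v' : 𝓢'(Plane, ℂ)}
    (h : IsFourierMultiplier m u v) (h' : IsFourierMultiplier m u v') : v = v' := by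
  obtain ⟨a, ha, hv⟩ := h
  obtain ⟨b, hb, hv'⟩ := h'
  have hab := ha.ae_unique hb
  have : 𝓕 v = 𝓕 v' := by
    ext φ
    rw [(hv φ).2, (hv' φ).2]
    refine integral_congr_ae ?_
    filter_upwards [hab] with x hx
    simp only [hx]
  have h2 := congrArg (fun T : 𝓢'(Plane, ℂ) => 𝓕⁻ T) this
  simpa using h2

/-- The phase `φ_ε(ξ) = ε|ξ|³ - |ξ|`. -/
noncomputable def phase (ε : ℝ) (ξ : Plane) : ℝ := ε * ‖ξ‖ ^ 3 - ‖ξ‖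

/-- `v = U_ε(t) u`, where `U_ε(t) = e^{i t φ_ε(D)}`. -/
def IsPropagated (ε t : ℝ) (u v : 𝓢'(Plane, ℂ)) : Prop :=
  IsFourierMultiplier (fun ξ => Complex.exp (Complex.I * ((t * phase ε ξ : ℝ) : ℂ))) u v

/-- `w = D^β v`, where `D^β = |D|^β` has the symbol `|ξ|^β`. -/
def IsFractionalDerivative (β : ℝ) (v w : 𝓢'(Plane, ℂ)) : Prop :=
  IsFourierMultiplier (fun ξ => ((‖ξ‖ ^ β : ℝ) : ℂ)) v w

end KdVDispersive

/-!
The operator `D^β U_ε(t)` is convolution with the oscillatory integral of its symbol, and the claim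
is a bound for that kernel, uniform in space. Polar coordinates and the scaling
`|ξ| = (ε|t|)^{-1/3} ρ` turn the kernel, cut off at a large frequency, into `(ε|t|)^{-(2+β)/3}`
times
`∫₀^R ρ^{1+β} e^{i(ρ³ - bρ)} J₀(sρ) dρ`, where `b = |t| (ε|t|)^{-1/3} = |t|^{2/3} ε^{-1/3}`.
It suffices to bound this by a multiple of `(1 + b)^{1/4+β/2}`
(`norm_integral_rpow_mul_cubicExp_mul_besselJ0_le`): for `|t| ≤ θ ε^{1/2}` the number `b` is
bounded, and for `|t| ≥ θ ε^{1/2}` one may replace `1 + b` by `b`, which gives the second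
expression (`short_time_bound`, `long_time_bound`).

For the radial integral, write `J₀(z) = e^{iz} h(z) + e^{-iz} conj (h(z))` with
`h = e^{-iz} (J₀ + i J₁) / 2`. A monotone energy for Bessel's equation gives `|h| ≲ z^{-1/2}` and
`|h'| ≲ z^{-3/2}`. The exponentials only shift the linear coefficient of the phase, so the phase
is again `ρ³ - aρ`, with `|a| ≤ b + s`. Two estimates for this phase are enough. The integrals of
`ρ^{1/2} e^{i(ρ³ - aρ)}` are bounded uniformly in `a`
(`norm_integral_sqrt_mul_cubicExp_le`), and those of `ρ^{1+β} e^{i(ρ³ - aρ)}` are bounded beyond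
`(1 + b + s)^{1/2}`, where the phase is not stationary
(`norm_integral_rpow_mul_cubicExp_tail`). The remaining factors, `ρ^{1/2+β} h(sρ)` and `h(sρ)`,
have controlled variation, and integration by parts (`norm_integral_mul_le`) concludes.

The cut-off kernels need not converge pointwise, so the function `w` is obtained by duality: tested
against Schwartz functions `ψ`, the multiplier is bounded by the `L¹` norm of `ψ`, and such a
functional is integration against an `L^∞` function
(`exists_memLp_top_of_schwartz_functional`).
-/

namespace KdVDispersive

open Set

/-! ### Oscillatory integrals with a cubic phase -/

/-- An integral `∫ f m` is controlled by the primitives of `f` and the variation of `m`. The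
variation is measured by any function `M` whose derivative dominates `‖m'‖`; this form needs no
integrability of `m'`, so it applies to amplitudes whose derivative is singular at an endpoint. -/
theorem norm_integral_mul_le {f m m' : ℝ → ℂ} {M M' : ℝ → ℝ} {x y B : ℝ} (hxy : x ≤ y)
    (hf : ContinuousOn f (Icc x y)) (hB : ∀ z ∈ Icc x y, ‖∫ t in x..z, f t‖ ≤ B)
    (hm : ContinuousOn m (Icc x y)) (hm' : ∀ t ∈ Ioo x y, HasDerivAt m (m' t) t)
    (hM : ContinuousOn M (Icc x y)) (hM' : ∀ t ∈ Ioo x y, HasDerivAt M (M' t) t)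
    (hle : ∀ t ∈ Ioo x y, ‖m' t‖ ≤ M' t) :
    ‖∫ t in x..y, f t * m t‖ ≤ B * (‖m y‖ + (M y - M x)) := by
  have hu : uIcc x y = Icc x y := uIcc_of_le hxy
  have hB0 : 0 ≤ B := (norm_nonneg _).trans (hB x (left_mem_Icc.2 hxy))
  have hfi : IntervalIntegrable f volume x y := (hu ▸ hf).intervalIntegrable
  have hM'i : IntervalIntegrable M' volume x y := by
    refine intervalIntegral.intervalIntegrable_deriv_of_nonneg (hu ▸ hM) ?_ ?_
    · rwa [min_eq_left hxy, max_eq_right hxy]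
    · rw [min_eq_left hxy, max_eq_right hxy]
      exact fun t ht => (norm_nonneg _).trans (hle t ht)
  have hae : ∀ᵐ t ∂(volume.restrict (Ioc x y)), t ∈ Ioo x y := by
    rw [← restrict_Ioo_eq_restrict_Ioc]
    exact ae_restrict_mem measurableSet_Ioo
  have hm'i : IntervalIntegrable m' volume x y := by
    rw [intervalIntegrable_iff_integrableOn_Ioc_of_le hxy] at hM'i ⊢
    refine hM'i.mono' ?_ ?_
    · refine (aestronglyMeasurable_deriv m _).congr ?_
      filter_upwards [hae] with t ht using (hm' t ht).deriv
    · filter_upwards [hae] with t ht using hle t ht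
  have hFc : ContinuousOn (fun z => ∫ t in x..z, f t) (Icc x y) := by
    have := intervalIntegral.continuousOn_primitive_interval (μ := volume) (f := f) (a := x) (b := y)
      (by rw [hu]; exact hf.integrableOn_Icc)
    rwa [hu] at this
  have hF' : ∀ t ∈ Ioo x y, HasDerivAt (fun z => ∫ t in x..z, f t) (f t) t := by
    intro t ht
    have hnh : Icc x y ∈ nhds t := Icc_mem_nhds ht.1 ht.2
    refine intervalIntegral.integral_hasDerivAt_right (hfi.mono_set ?_) ?_ (hf.continuousAt hnh)
    · rw [hu, uIcc_of_le ht.1.le]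
      exact Icc_subset_Icc le_rfl ht.2.le
    · exact hf.stronglyMeasurableAtFilter_nhdsWithin measurableSet_Icc t |>.filter_mono
        (le_of_eq (nhdsWithin_eq_nhds.2 hnh).symm)
  have hM'int : ∫ t in x..y, M' t = M y - M x :=
    intervalIntegral.integral_eq_sub_of_hasDerivAt_of_le hxy hM hM' hM'i
  have key := intervalIntegral.integral_deriv_mul_eq_sub_of_hasDeriv_right
    (u := fun z => ∫ t in x..z, f t) (v := m) (a := x) (b := y) (u' := f) (v' := m')
    (hu ▸ hFc) (hu ▸ hm)
    (by rw [min_eq_left hxy, max_eq_right hxy]; exact fun t ht => (hF' t ht).hasDerivWithinAt)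
    (by rw [min_eq_left hxy, max_eq_right hxy]; exact fun t ht => (hm' t ht).hasDerivWithinAt)
    hfi hm'i
  have hi1 : IntervalIntegrable (fun t => f t * m t) volume x y :=
    hfi.mul_continuousOn (hu ▸ hm)
  have hi2 : IntervalIntegrable (fun t => (∫ s in x..t, f s) * m' t) volume x y :=
    hm'i.continuousOn_mul (hu ▸ hFc)
  rw [intervalIntegral.integral_add hi1 hi2] at key
  simp only [intervalIntegral.integral_same, zero_mul, sub_zero] at key
  rw [eq_sub_of_add_eq key]
  refine (norm_sub_le _ _).trans ?_
  rw [mul_add, norm_mul]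
  refine add_le_add (mul_le_mul_of_nonneg_right (hB y (right_mem_Icc.2 hxy)) (norm_nonneg _)) ?_
  rw [← hM'int, ← intervalIntegral.integral_const_mul]
  refine intervalIntegral.norm_integral_le_of_norm_le hxy ?_ (hM'i.const_mul B)
  have := (ae_restrict_iff' (measurableSet_Ioc)).1 hae
  filter_upwards [this] with t ht hti
  have hti := ht hti
  rw [norm_mul]
  exact mul_le_mul (hB t ⟨hti.1.le, hti.2.le⟩) (hle t hti) (norm_nonneg _) hB0

/-- The exponential `e^{i(ρ³ - aρ)}`. -/
noncomputable def cubicExp (a ρ : ℝ) : ℂ := Complex.exp (Complex.I * ((ρ ^ 3 - a * ρ : ℝ) : ℂ))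

theorem norm_cubicExp (a ρ : ℝ) : ‖cubicExp a ρ‖ = 1 := by
  rw [cubicExp, mul_comm]; exact Complex.norm_exp_ofReal_mul_I _

theorem hasDerivAt_cubicExp (a ρ : ℝ) :
    HasDerivAt (cubicExp a) (Complex.I * (((3 * ρ ^ 2 - a : ℝ) : ℂ) * cubicExp a ρ)) ρ := by
  have h : HasDerivAt (fun ρ : ℝ => ρ ^ 3 - a * ρ) (3 * ρ ^ 2 - a) ρ := by
    simpa using! (hasDerivAt_pow 3 ρ).sub ((hasDerivAt_id ρ).const_mul a)
  have := ((h.ofReal_comp).const_mul Complex.I).cexp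
  refine this.congr_deriv ?_
  simp only [cubicExp]; ring

@[fun_prop]
theorem continuous_cubicExp (a : ℝ) : Continuous (cubicExp a) := by
  unfold cubicExp; fun_prop

/-- First derivative test: an amplitude written as `W ψ'`, where `ψ' = 3t² - a` is the derivative
of the phase, has an oscillatory integral bounded by twice the supremum plus variation of `W`. -/
theorem norm_integral_cubicExp_mul_le {a x y : ℝ} {W W' M M' : ℝ → ℝ} (hxy : x ≤ y)
    (hW : ContinuousOn W (Icc x y)) (hW' : ∀ t ∈ Ioo x y, HasDerivAt W (W' t) t)
    (hM : ContinuousOn M (Icc x y)) (hM' : ∀ t ∈ Ioo x y, HasDerivAt M (M' t) t)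
    (hle : ∀ t ∈ Ioo x y, |W' t| ≤ M' t) :
    ‖∫ t in x..y, ((W t * (3 * t ^ 2 - a) : ℝ) : ℂ) * cubicExp a t‖
      ≤ 2 * (|W y| + (M y - M x)) := by
  have h := norm_integral_mul_le (f := fun t => Complex.I * (((3 * t ^ 2 - a : ℝ) : ℂ) * cubicExp a t))
    (m := fun t => ((W t : ℝ) : ℂ)) (m' := fun t => ((W' t : ℝ) : ℂ)) (B := 2) hxy
    (by fun_prop) ?_ (Complex.continuous_ofReal.comp_continuousOn hW)
    (fun t ht => (hW' t ht).ofReal_comp) hM hM' (by simpa using hle)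
  · rw [Complex.norm_real, Real.norm_eq_abs] at h
    refine le_trans (le_of_eq ?_) h
    have : ∀ t, Complex.I * (((3 * t ^ 2 - a : ℝ) : ℂ) * cubicExp a t) * ((W t : ℝ) : ℂ)
        = Complex.I * (((W t * (3 * t ^ 2 - a) : ℝ) : ℂ) * cubicExp a t) := by
      intro t; push_cast; ring
    simp_rw [this]
    rw [intervalIntegral.integral_const_mul, norm_mul, Complex.norm_I, one_mul]
  · intro z _
    rw [intervalIntegral.integral_eq_sub_of_hasDerivAt (fun t _ => hasDerivAt_cubicExp a t)
      (by apply Continuous.intervalIntegrable; fun_prop)]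
    refine (norm_sub_le _ _).trans ?_
    rw [norm_cubicExp, norm_cubicExp]; norm_num

/-- Away from the stationary point the amplitude `t^{1+β}` still has bounded oscillatory integrals,
uniformly in the endpoints: although `∫ t^{1+β} / t³` diverges logarithmically for `β = 1`, the
quotient of `t^{1+β}` by the derivative of the phase has bounded variation. -/
theorem norm_integral_rpow_mul_cubicExp_tail {β a x y r : ℝ} (hβ0 : 0 ≤ β) (hβ1 : β ≤ 1)
    (hr : 1 ≤ r) (ha : |a| ≤ r ^ 2) (hrx : r ≤ x) (hxy : x ≤ y) :
    ‖∫ t in x..y, ((t ^ (1 + β) : ℝ) : ℂ) * cubicExp a t‖ ≤ 3 := by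
  have hψ : ∀ t ∈ Icc x y, 2 * t ^ 2 ≤ 3 * t ^ 2 - a := by
    intro t ht
    have : r ^ 2 ≤ t ^ 2 := by gcongr; linarith [ht.1]
    linarith [le_abs_self a]
  have ht0 : ∀ t ∈ Icc x y, 1 ≤ t := fun t ht => by linarith [ht.1]
  have hψ0 : ∀ t ∈ Icc x y, 0 < 3 * t ^ 2 - a := fun t ht => by
    have := ht0 t ht; have := hψ t ht; nlinarith
  have hW' : ∀ t ∈ Icc x y, HasDerivAt (fun t : ℝ => t ^ (1 + β) / (3 * t ^ 2 - a))
      (((1 + β) * t ^ β * (3 * t ^ 2 - a) - t ^ (1 + β) * (6 * t)) / (3 * t ^ 2 - a) ^ 2) t := by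
    intro t ht
    have h1 : HasDerivAt (fun t : ℝ => t ^ (1 + β)) ((1 + β) * t ^ β) t := by
      simpa using Real.hasDerivAt_rpow_const (x := t) (p := 1 + β) (Or.inl (by linarith [ht0 t ht]))
    have h2 : HasDerivAt (fun t : ℝ => 3 * t ^ 2 - a) (6 * t) t := by
      refine (((hasDerivAt_pow 2 t).const_mul 3).sub_const a).congr_deriv ?_
      norm_num; ring
    exact h1.div h2 (hψ0 t ht).ne'
  have hM' : ∀ t ∈ Icc x y, HasDerivAt (fun t : ℝ => -(3 / 4) * t ^ (β - 1) - r ^ 2 / 4 * t ^ (-2 : ℝ))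
      (3 / 4 * (1 - β) * t ^ (β - 2) + r ^ 2 / 2 * t ^ (-3 : ℝ)) t := by
    intro t ht
    have h1 := (Real.hasDerivAt_rpow_const (x := t) (p := β - 1)
      (Or.inl (by linarith [ht0 t ht]))).const_mul (-(3 / 4))
    have h2 := (Real.hasDerivAt_rpow_const (x := t) (p := -2)
      (Or.inl (by linarith [ht0 t ht]))).const_mul (r ^ 2 / 4)
    refine (h1.sub h2).congr_deriv ?_
    rw [show β - 1 - 1 = β - 2 by ring, show (-2 : ℝ) - 1 = -3 by norm_num]; ring
  have h := norm_integral_cubicExp_mul_le (a := a) hxy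
    (fun t ht => (hW' t ht).continuousAt.continuousWithinAt)
    (fun t ht => hW' t (Ioo_subset_Icc_self ht))
    (fun t ht => (hM' t ht).continuousAt.continuousWithinAt)
    (fun t ht => hM' t (Ioo_subset_Icc_self ht)) ?_
  · have e : ∫ t in x..y, ((t ^ (1 + β) : ℝ) : ℂ) * cubicExp a t
        = ∫ t in x..y, ((t ^ (1 + β) / (3 * t ^ 2 - a) * (3 * t ^ 2 - a) : ℝ) : ℂ) * cubicExp a t := by
      refine intervalIntegral.integral_congr fun t ht => ?_
      rw [uIcc_of_le hxy] at ht
      rw [div_mul_cancel₀ _ (hψ0 t ht).ne']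
    rw [e]
    refine h.trans ?_
    have hy := ht0 y (right_mem_Icc.2 hxy)
    have hx := ht0 x (left_mem_Icc.2 hxy)
    have b1 : |y ^ (1 + β) / (3 * y ^ 2 - a)| ≤ 1 / 2 := by
      have : 0 ≤ y ^ (1 + β) := by positivity
      rw [abs_of_nonneg (div_nonneg this (hψ0 y (right_mem_Icc.2 hxy)).le),
        div_le_iff₀ (hψ0 y (right_mem_Icc.2 hxy))]
      have h1 : y ^ (1 + β) ≤ y ^ (2 : ℝ) := Real.rpow_le_rpow_of_exponent_le hy (by linarith)
      rw [Real.rpow_two] at h1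
      linarith [hψ y (right_mem_Icc.2 hxy)]
    have b2 : x ^ (β - 1) ≤ 1 := Real.rpow_le_one_of_one_le_of_nonpos hx (by linarith)
    have b3 : r ^ 2 * x ^ (-2 : ℝ) ≤ 1 := by
      rw [Real.rpow_neg (by linarith), Real.rpow_two, ← div_eq_mul_inv, div_le_one (by positivity)]
      gcongr
    have b4 : 0 ≤ y ^ (β - 1) := by positivity
    have b5 : 0 ≤ r ^ 2 * y ^ (-2 : ℝ) := by positivity
    linarith
  · intro t ht
    have ht := Ioo_subset_Icc_self ht
    have h1 := ht0 t ht
    have hp : 0 < t := by linarith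
    have e1 : (1 + β) * t ^ β * (3 * t ^ 2 - a) - t ^ (1 + β) * (6 * t)
        = t ^ β * (-(3 * (1 - β) * t ^ 2) - (1 + β) * a) := by
      rw [Real.rpow_add hp, Real.rpow_one]; ring
    have e2 : 3 / 4 * (1 - β) * t ^ (β - 2) + r ^ 2 / 2 * t ^ (-3 : ℝ)
        = (t ^ β * (3 * (1 - β) * t ^ 2) + t * (2 * r ^ 2)) / (2 * t ^ 2) ^ 2 := by
      rw [Real.rpow_sub hp, Real.rpow_two, Real.rpow_neg hp.le,
        show (3 : ℝ) = (3 : ℕ) by norm_num, Real.rpow_natCast]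
      field_simp
      ring
    rw [e1, e2, abs_div, abs_of_nonneg (a := (3 * t ^ 2 - a) ^ 2) (sq_nonneg _)]
    have hb : t ^ β ≤ t := by
      simpa using Real.rpow_le_rpow_of_exponent_le h1 hβ1
    have hb0 : 0 ≤ t ^ β := by positivity
    have n1 : |t ^ β * (-(3 * (1 - β) * t ^ 2) - (1 + β) * a)|
        ≤ t ^ β * (3 * (1 - β) * t ^ 2) + t * (2 * r ^ 2) := by
      rw [abs_mul, abs_of_nonneg hb0]
      have : |-(3 * (1 - β) * t ^ 2) - (1 + β) * a| ≤ 3 * (1 - β) * t ^ 2 + 2 * r ^ 2 := by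
        refine (abs_sub _ _).trans ?_
        rw [abs_neg, abs_of_nonneg (mul_nonneg (by linarith) (sq_nonneg t)), abs_mul,
          abs_of_nonneg (by linarith : 0 ≤ 1 + β)]
        have : (1 + β) * |a| ≤ 2 * r ^ 2 := by
          apply mul_le_mul (by linarith) ha (abs_nonneg _) (by norm_num)
        linarith
      calc _ ≤ t ^ β * (3 * (1 - β) * t ^ 2 + 2 * r ^ 2) := by gcongr
        _ = t ^ β * (3 * (1 - β) * t ^ 2) + t ^ β * (2 * r ^ 2) := by ring
        _ ≤ _ := by gcongr
    have hd := hψ t ht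
    gcongr

theorem norm_integral_sqrt_mul_cubicExp_trivial {a x y : ℝ} (hxy : x ≤ y) :
    ‖∫ t in x..y, ((√t : ℝ) : ℂ) * cubicExp a t‖ ≤ √y * (y - x) := by
  rw [← abs_of_nonneg (sub_nonneg.2 hxy)]
  refine intervalIntegral.norm_integral_le_of_norm_le_const fun t ht => ?_
  rw [uIoc_of_le hxy] at ht
  rw [norm_mul, norm_cubicExp, mul_one, Complex.norm_real, Real.norm_eq_abs,
    abs_of_nonneg (Real.sqrt_nonneg _)]
  exact Real.sqrt_le_sqrt ht.2

theorem integral_sqrt_mul_cubicExp_add (a x y z : ℝ) :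
    ∫ t in x..z, ((√t : ℝ) : ℂ) * cubicExp a t =
      (∫ t in x..y, ((√t : ℝ) : ℂ) * cubicExp a t) +
        ∫ t in y..z, ((√t : ℝ) : ℂ) * cubicExp a t := by
  rw [intervalIntegral.integral_add_adjacent_intervals] <;>
    (apply Continuous.intervalIntegrable; fun_prop)

theorem hasDerivAt_sqrt_div {a t : ℝ} (ht : 0 < t) (h : 3 * t ^ 2 - a ≠ 0) :
    HasDerivAt (fun t : ℝ => √t / (3 * t ^ 2 - a))
      (-(9 * t ^ 2 + a) / (2 * √t * (3 * t ^ 2 - a) ^ 2)) t := by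
  have h2 : HasDerivAt (fun t : ℝ => 3 * t ^ 2 - a) (6 * t) t := by
    refine (((hasDerivAt_pow 2 t).const_mul 3).sub_const a).congr_deriv ?_
    norm_num; ring
  refine ((Real.hasDerivAt_sqrt ht.ne').div h2 h).congr_deriv ?_
  have hs : √t ≠ 0 := (Real.sqrt_pos.2 ht).ne'
  have e : √t ^ 2 = t := Real.sq_sqrt ht.le
  field_simp
  rw [e]; ring

theorem integral_sqrt_mul_cubicExp_eq {a x y : ℝ} (hxy : x ≤ y)
    (h : ∀ t ∈ Icc x y, 3 * t ^ 2 - a ≠ 0) :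
    ∫ t in x..y, ((√t : ℝ) : ℂ) * cubicExp a t
      = ∫ t in x..y, ((√t / (3 * t ^ 2 - a) * (3 * t ^ 2 - a) : ℝ) : ℂ) * cubicExp a t := by
  refine intervalIntegral.integral_congr fun t ht => ?_
  rw [uIcc_of_le hxy] at ht
  rw [div_mul_cancel₀ _ (h t ht)]

theorem norm_integral_sqrt_mul_cubicExp_of_nonpos {a x y : ℝ} (ha : a ≤ 0) (hx : 1 ≤ x)
    (hxy : x ≤ y) : ‖∫ t in x..y, ((√t : ℝ) : ℂ) * cubicExp a t‖ ≤ 3 := by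
  have ht0 : ∀ t ∈ Icc x y, 1 ≤ t := fun t ht => hx.trans ht.1
  have hψ : ∀ t ∈ Icc x y, 0 < 3 * t ^ 2 - a := fun t ht => by
    have := ht0 t ht; nlinarith
  have hW' : ∀ t ∈ Icc x y, HasDerivAt (fun t : ℝ => √t / (3 * t ^ 2 - a)) _ t :=
    fun t ht => hasDerivAt_sqrt_div (by linarith [ht0 t ht]) (hψ t ht).ne'
  have hM' : ∀ t ∈ Icc x y, HasDerivAt (fun t : ℝ => -(1 / 2) * t⁻¹) (1 / (2 * t ^ 2)) t := by
    intro t ht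
    have h0 : t ≠ 0 := by linarith [ht0 t ht]
    refine ((hasDerivAt_inv h0).const_mul (-(1 / 2))).congr_deriv ?_
    field_simp
  rw [integral_sqrt_mul_cubicExp_eq hxy fun t ht => (hψ t ht).ne']
  refine (norm_integral_cubicExp_mul_le (a := a) hxy
    (fun t ht => (hW' t ht).continuousAt.continuousWithinAt)
    (fun t ht => hW' t (Ioo_subset_Icc_self ht))
    (fun t ht => (hM' t ht).continuousAt.continuousWithinAt)
    (fun t ht => hM' t (Ioo_subset_Icc_self ht)) ?_).trans ?_
  · intro t ht
    have ht := Ioo_subset_Icc_self ht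
    have h1 := ht0 t ht
    have hs : 1 ≤ √t := Real.one_le_sqrt.2 h1
    have hp := hψ t ht
    rw [abs_div, abs_of_pos (a := 2 * √t * (3 * t ^ 2 - a) ^ 2) (by positivity), abs_neg,
      div_le_div_iff₀ (by positivity) (by positivity)]
    have h2 : |9 * t ^ 2 + a| ≤ 3 * (3 * t ^ 2 - a) := by
      rw [abs_le]; constructor <;> nlinarith
    have h3 : 3 * t ^ 2 ≤ 3 * t ^ 2 - a := by linarith
    calc |9 * t ^ 2 + a| * (2 * t ^ 2) ≤ 3 * (3 * t ^ 2 - a) * (2 * t ^ 2) := by gcongr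
      _ = (2 * (3 * t ^ 2 - a)) * (3 * t ^ 2) := by ring
      _ ≤ (2 * (3 * t ^ 2 - a)) * (3 * t ^ 2 - a) := by gcongr
      _ = 2 * 1 * (3 * t ^ 2 - a) ^ 2 := by ring
      _ ≤ 2 * √t * (3 * t ^ 2 - a) ^ 2 := by gcongr
      _ = _ := by ring
  · have hy := ht0 y (right_mem_Icc.2 hxy)
    have hp := hψ y (right_mem_Icc.2 hxy)
    have b1 : |√y / (3 * y ^ 2 - a)| ≤ 1 := by
      rw [abs_of_nonneg (by positivity), div_le_one hp]
      have : √y ≤ y := by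
        rw [Real.sqrt_le_left (by linarith)]; nlinarith
      nlinarith
    have b2 : x⁻¹ ≤ 1 := inv_le_one_of_one_le₀ hx
    have b3 : 0 ≤ y⁻¹ := by positivity
    linarith

/-- Outside the interval of radius `(1 + r)^{-1/2}` about the stationary point `r`, the amplitude
`√t` is at most half of the absolute value of the derivative of the phase `t³ - 3r²t`. -/
theorem abs_sqrt_div_le {r t : ℝ} (hr : 0 ≤ r) (ht : 0 ≤ t) (h : 1 / √(1 + r) ≤ |t - r|) :
    |√t / (3 * t ^ 2 - 3 * r ^ 2)| ≤ 1 / 2 := by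
  have hs : 0 < √(1 + r) := Real.sqrt_pos.2 (by linarith)
  have hss : √(1 + r) ^ 2 = 1 + r := Real.sq_sqrt (by linarith)
  have h1 : 1 ≤ |t - r| * √(1 + r) := by rwa [div_le_iff₀ hs] at h
  have htr : |t - r| ≤ t + r := by rw [abs_le]; constructor <;> linarith
  have h2 : 1 ≤ (t + r) ^ 2 * (1 + r) := by
    rw [← hss, ← mul_pow]
    apply one_le_pow₀
    exact h1.trans (by gcongr)
  have h3 : t * (1 + r) ≤ 2 * (t + r) ^ 2 := by
    by_cases hr1 : 1 ≤ r
    · nlinarith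
    · push Not at hr1
      have h4 : 1 ≤ 2 * (t + r) ^ 2 := by nlinarith [sq_nonneg (t + r)]
      have h5 : 1 ≤ 2 * (t + r) := by nlinarith
      nlinarith [sq_nonneg (t - r), sq_nonneg (2 * (t + r) - 1)]
  have hpos : 0 < |t - r| := by
    by_contra hc
    have : |t - r| = 0 := le_antisymm (not_lt.1 hc) (abs_nonneg _)
    rw [this] at h1; norm_num at h1
  have htr0 : 0 < t + r := hpos.trans_le htr
  have e : 3 * t ^ 2 - 3 * r ^ 2 = 3 * ((t - r) * (t + r)) := by ring
  rw [e, abs_div, abs_of_nonneg (Real.sqrt_nonneg t), abs_mul, abs_mul, abs_of_pos htr0,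
    abs_of_pos (by norm_num : (0 : ℝ) < 3), div_le_iff₀ (by positivity)]
  have h6 : √t * √(1 + r) ≤ 3 / 2 * (t + r) := by
    rw [← Real.sqrt_mul ht, Real.sqrt_le_left (by positivity)]
    nlinarith
  calc √t = √t * 1 := by ring
    _ ≤ √t * (|t - r| * √(1 + r)) := by gcongr
    _ = |t - r| * (√t * √(1 + r)) := by ring
    _ ≤ |t - r| * (3 / 2 * (t + r)) := by gcongr
    _ = _ := by ring

/-- On an interval that stays at distance `(1 + r)^{-1/2}` from the stationary point, the quotient of
`√t` by the derivative of the phase is decreasing and bounded. -/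
theorem norm_integral_sqrt_mul_cubicExp_off {r x y : ℝ} (hr : 0 ≤ r) (hx : 0 ≤ x) (hxy : x ≤ y)
    (h : ∀ t ∈ Icc x y, 1 / √(1 + r) ≤ |t - r|) :
    ‖∫ t in x..y, ((√t : ℝ) : ℂ) * cubicExp (3 * r ^ 2) t‖ ≤ 3 := by
  have hs : 0 < 1 / √(1 + r) := by positivity
  have h0 : ∀ t ∈ Icc x y, 3 * t ^ 2 - 3 * r ^ 2 ≠ 0 := by
    intro t ht he
    have h1 := h t ht
    have : t ^ 2 = r ^ 2 := by linarith
    have : t = r := by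
      rwa [sq_eq_sq₀ (hx.trans ht.1) hr] at this
    rw [this, sub_self, abs_zero] at h1
    linarith
  have hW' : ∀ t ∈ Ioo x y, HasDerivAt (fun t : ℝ => √t / (3 * t ^ 2 - 3 * r ^ 2)) _ t :=
    fun t ht => hasDerivAt_sqrt_div (by linarith [ht.1]) (h0 t (Ioo_subset_Icc_self ht))
  have hWc : ContinuousOn (fun t : ℝ => √t / (3 * t ^ 2 - 3 * r ^ 2)) (Icc x y) :=
    ContinuousOn.div (by fun_prop) (by fun_prop) h0
  rw [integral_sqrt_mul_cubicExp_eq hxy h0]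
  refine (norm_integral_cubicExp_mul_le (a := 3 * r ^ 2) hxy hWc hW' hWc.neg
    (fun t ht => (hW' t ht).neg) ?_).trans ?_
  · intro t ht
    rw [abs_of_nonpos]
    refine div_nonpos_of_nonpos_of_nonneg (by nlinarith) (by positivity)
  · have b1 := abs_le.1 (abs_sqrt_div_le hr hx (h x (left_mem_Icc.2 hxy)))
    have b2 := abs_sqrt_div_le hr (hx.trans hxy) (h y (right_mem_Icc.2 hxy))
    have b3 := abs_le.1 b2
    simp only [Pi.neg_apply]
    linarith

/-- The amplitude `√t` compensates exactly the degeneracy of the second derivative `6t` of the phase: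
the integrals of `√t e^{i(t³ - at)}` over subintervals of `[0, ∞)` are bounded uniformly in `a`
and in the endpoints. -/
theorem norm_integral_sqrt_mul_cubicExp_le {a x y : ℝ} (hx : 0 ≤ x) (hxy : x ≤ y) :
    ‖∫ t in x..y, ((√t : ℝ) : ℂ) * cubicExp a t‖ ≤ 8 := by
  rcases le_total a 0 with ha | ha
  · have h1 : ∀ y', x ≤ y' → y' ≤ 1 → ‖∫ t in x..y', ((√t : ℝ) : ℂ) * cubicExp a t‖ ≤ 1 := by
      intro y' h h'
      refine (norm_integral_sqrt_mul_cubicExp_trivial h).trans ?_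
      have : √y' ≤ 1 := Real.sqrt_le_one.2 h'
      nlinarith [Real.sqrt_nonneg y']
    rcases le_total y 1 with hy | hy
    · linarith [h1 y hxy hy]
    rcases le_total x 1 with hx1 | hx1
    · rw [integral_sqrt_mul_cubicExp_add a x 1 y]
      refine (norm_add_le _ _).trans ?_
      linarith [h1 1 hx1 le_rfl, norm_integral_sqrt_mul_cubicExp_of_nonpos ha le_rfl hy]
    · linarith [norm_integral_sqrt_mul_cubicExp_of_nonpos ha hx1 hxy]
  · obtain ⟨r, hr, rfl⟩ : ∃ r : ℝ, 0 ≤ r ∧ a = 3 * r ^ 2 :=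
      ⟨√(a / 3), Real.sqrt_nonneg _, by rw [Real.sq_sqrt (by positivity)]; ring⟩
    have hs1 : 1 ≤ √(1 + r) := Real.one_le_sqrt.2 (by linarith)
    have hd : 0 < 1 / √(1 + r) := by positivity
    have hd1 : 1 / √(1 + r) ≤ 1 := by rw [div_le_one (by positivity)]; exact hs1
    have hds : 1 / √(1 + r) * √(1 + r) = 1 := by field_simp
    set d := 1 / √(1 + r) with hdd
    have P1 : ∀ u v, 0 ≤ u → u ≤ v → v ≤ max u (r - d) →
        ‖∫ t in u..v, ((√t : ℝ) : ℂ) * cubicExp (3 * r ^ 2) t‖ ≤ 3 := by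
      intro u v hu huv hv
      rcases le_total u (r - d) with h | h
      · rw [max_eq_right h] at hv
        refine norm_integral_sqrt_mul_cubicExp_off hr hu huv fun t ht => ?_
        rw [abs_of_nonpos (by linarith [ht.2])]
        linarith [ht.2]
      · rw [max_eq_left h] at hv
        rw [le_antisymm hv huv]; simp
    have P2 : ∀ u v, u ≤ v → v ≤ max u (r + d) → r - d ≤ u →
        ‖∫ t in u..v, ((√t : ℝ) : ℂ) * cubicExp (3 * r ^ 2) t‖ ≤ 2 := by
      intro u v huv hv h'
      rcases le_total u (r + d) with h | h
      · rw [max_eq_right h] at hv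
        refine (norm_integral_sqrt_mul_cubicExp_trivial huv).trans ?_
        have h2 : √v ≤ √(1 + r) := Real.sqrt_le_sqrt (by linarith)
        calc √v * (v - u) ≤ √(1 + r) * (2 * d) :=
              mul_le_mul h2 (by linarith) (by linarith) (by positivity)
          _ = 2 := by linarith
      · rw [max_eq_left h] at hv
        rw [le_antisymm hv huv]; simp
    have P3 : ∀ u v, 0 ≤ u → u ≤ v → r + d ≤ u →
        ‖∫ t in u..v, ((√t : ℝ) : ℂ) * cubicExp (3 * r ^ 2) t‖ ≤ 3 := by
      intro u v hu huv h
      refine norm_integral_sqrt_mul_cubicExp_off hr hu huv fun t ht => ?_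
      rw [abs_of_nonneg (by linarith [ht.1])]
      linarith [ht.1]
    -- Cut `[x, y]` at the points `r ± d`, clamped to the interval.
    rcases le_total y (max x (r - d)) with h1 | h1
    · linarith [P1 x y hx hxy h1]
    have hc1 : x ≤ max x (r - d) := le_max_left _ _
    rw [integral_sqrt_mul_cubicExp_add _ x (max x (r - d)) y]
    have A := P1 x _ hx hc1 le_rfl
    rcases le_total y (max (max x (r - d)) (r + d)) with h2 | h2
    · have B := P2 _ y h1 h2 (le_max_right _ _)
      exact (norm_add_le _ _).trans (by linarith)
    · rw [integral_sqrt_mul_cubicExp_add _ (max x (r - d)) (max (max x (r - d)) (r + d)) y]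
      have B := P2 _ _ (le_max_left (max x (r - d)) (r + d)) le_rfl (le_max_right _ _)
      have C := P3 _ y (hx.trans (hc1.trans (le_max_left _ _))) h2 (le_max_right _ _)
      refine (norm_add_le _ _).trans ?_
      refine (add_le_add A ((norm_add_le _ _).trans (add_le_add B C))).trans ?_
      norm_num

/-! ### Bessel functions of orders zero and one -/

/-- The Bessel function `J₀`, by its integral representation. -/
noncomputable def besselJ0 (z : ℝ) : ℝ :=
  (2 * Real.pi)⁻¹ * ∫ ω in (-Real.pi)..Real.pi, Real.cos (z * Real.cos ω)

/-- The Bessel function `J₁`, by its integral representation. -/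
noncomputable def besselJ1 (z : ℝ) : ℝ :=
  (2 * Real.pi)⁻¹ * ∫ ω in (-Real.pi)..Real.pi, Real.cos ω * Real.sin (z * Real.cos ω)

/-- The entire function `J₁(z) / z`, by an integral that makes sense at `z = 0` (see
`besselJ1_eq`). -/
noncomputable def besselJ1Div (z : ℝ) : ℝ :=
  (2 * Real.pi)⁻¹ * ∫ ω in (-Real.pi)..Real.pi, Real.sin ω ^ 2 * Real.cos (z * Real.cos ω)

theorem hasDerivAt_integral_of_bounded {F F' : ℝ → ℝ → ℝ} (hF : ∀ z, Continuous (F z))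
    (hF' : ∀ z, Continuous (F' z)) (hd : ∀ z ω, HasDerivAt (fun z => F z ω) (F' z ω) z)
    (hb : ∀ z ω, |F' z ω| ≤ 1) (z a b : ℝ) :
    HasDerivAt (fun z => ∫ ω in a..b, F z ω) (∫ ω in a..b, F' z ω) z := by
  refine (intervalIntegral.hasDerivAt_integral_of_dominated_loc_of_deriv_le (bound := fun _ => 1)
    (s := univ) Filter.univ_mem ?_ ?_ ?_ ?_ ?_ ?_).2
  · exact Filter.Eventually.of_forall fun x => (hF x).aestronglyMeasurable
  · exact (hF z).intervalIntegrable _ _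
  · exact (hF' z).aestronglyMeasurable
  · exact Filter.Eventually.of_forall fun ω _ x _ => by simpa using hb x ω
  · exact intervalIntegrable_const
  · exact Filter.Eventually.of_forall fun ω _ x _ => hd x ω

theorem abs_circleMean_le_one {f : ℝ → ℝ} (h : ∀ ω, |f ω| ≤ 1) :
    |(2 * Real.pi)⁻¹ * ∫ ω in (-Real.pi)..Real.pi, f ω| ≤ 1 := by
  have hp := Real.pi_pos
  have := intervalIntegral.norm_integral_le_of_norm_le_const (a := -Real.pi) (b := Real.pi)
    (f := f) (C := 1) (fun ω _ => h ω)
  rw [abs_mul, abs_of_pos (by positivity : 0 < (2 * Real.pi)⁻¹), inv_mul_le_iff₀ (by positivity)]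
  rw [Real.norm_eq_abs, abs_of_pos (by linarith : 0 < Real.pi - -Real.pi)] at this
  linarith

theorem abs_besselJ0_le_one (z : ℝ) : |besselJ0 z| ≤ 1 :=
  abs_circleMean_le_one fun _ => Real.abs_cos_le_one _

theorem abs_besselJ1_le_one (z : ℝ) : |besselJ1 z| ≤ 1 :=
  abs_circleMean_le_one fun ω => by
    rw [abs_mul]
    exact mul_le_one₀ (Real.abs_cos_le_one _) (abs_nonneg _) (Real.abs_sin_le_one _)

theorem abs_besselJ1Div_le_one (z : ℝ) : |besselJ1Div z| ≤ 1 :=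
  abs_circleMean_le_one fun ω => by
    rw [abs_mul]
    refine mul_le_one₀ ?_ (abs_nonneg _) (Real.abs_cos_le_one _)
    rw [abs_of_nonneg (sq_nonneg _)]
    exact Real.sin_sq_le_one ω

theorem hasDerivAt_besselJ0 (z : ℝ) : HasDerivAt besselJ0 (-besselJ1 z) z := by
  have h := hasDerivAt_integral_of_bounded (F := fun z ω => Real.cos (z * Real.cos ω))
    (F' := fun z ω => -(Real.cos ω * Real.sin (z * Real.cos ω)))
    (fun z => by fun_prop) (fun z => by fun_prop) (fun z ω => ?_) (fun z ω => ?_)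
    z (-Real.pi) Real.pi
  · refine (h.const_mul (2 * Real.pi)⁻¹).congr_deriv ?_
    rw [intervalIntegral.integral_neg, besselJ1]; ring
  · refine (((hasDerivAt_id z).mul_const (Real.cos ω)).cos).congr_deriv ?_
    simp; ring
  · rw [abs_neg, abs_mul]
    exact mul_le_one₀ (Real.abs_cos_le_one _) (abs_nonneg _) (Real.abs_sin_le_one _)

theorem hasDerivAt_besselJ1 (z : ℝ) :
    HasDerivAt besselJ1 (besselJ0 z - besselJ1Div z) z := by
  have h := hasDerivAt_integral_of_bounded (F := fun z ω => Real.cos ω * Real.sin (z * Real.cos ω))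
    (F' := fun z ω => Real.cos (z * Real.cos ω) - Real.sin ω ^ 2 * Real.cos (z * Real.cos ω))
    (fun z => by fun_prop) (fun z => by fun_prop) (fun z ω => ?_) (fun z ω => ?_)
    z (-Real.pi) Real.pi
  · refine (h.const_mul (2 * Real.pi)⁻¹).congr_deriv ?_
    rw [intervalIntegral.integral_sub, besselJ0, besselJ1Div, mul_sub] <;>
    (apply Continuous.intervalIntegrable; fun_prop)
  · refine ((((hasDerivAt_id z).mul_const (Real.cos ω)).sin).const_mul (Real.cos ω)).congr_deriv ?_
    have := Real.cos_sq_add_sin_sq ω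
    simp only [id]
    linear_combination (Real.cos (z * Real.cos ω)) * this
  · have : Real.cos (z * Real.cos ω) - Real.sin ω ^ 2 * Real.cos (z * Real.cos ω)
        = Real.cos ω ^ 2 * Real.cos (z * Real.cos ω) := by
      rw [Real.cos_sq' ω]; ring
    rw [this, abs_mul]
    refine mul_le_one₀ ?_ (abs_nonneg _) (Real.abs_cos_le_one _)
    rw [abs_of_nonneg (sq_nonneg _)]
    exact Real.cos_sq_le_one ω

theorem besselJ1_eq (z : ℝ) : besselJ1 z = z * besselJ1Div z := by
  have h := intervalIntegral.integral_deriv_mul_eq_sub (a := -Real.pi) (b := Real.pi)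
    (u := Real.sin) (u' := Real.cos) (v := fun ω => Real.sin (z * Real.cos ω))
    (v' := fun ω => Real.cos (z * Real.cos ω) * (z * (-Real.sin ω)))
    (fun ω _ => Real.hasDerivAt_sin ω)
    (fun ω _ => ((Real.hasDerivAt_cos ω).const_mul z).sin)
    (by apply Continuous.intervalIntegrable; fun_prop)
    (by apply Continuous.intervalIntegrable; fun_prop)
  simp only [Real.sin_neg, Real.sin_pi, neg_zero, zero_mul, sub_zero] at h
  rw [intervalIntegral.integral_add (by apply Continuous.intervalIntegrable; fun_prop)
    (by apply Continuous.intervalIntegrable; fun_prop)] at h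
  rw [besselJ1, besselJ1Div, eq_neg_of_add_eq_zero_left h, ← intervalIntegral.integral_neg,
    mul_left_comm, ← intervalIntegral.integral_const_mul z]
  congr 2
  ext ω
  ring

/-- Decay of the Bessel functions from a Sonin energy: `√z J₀` solves
`u'' + (1 + 1 / (4 z²)) u = 0`, so that `u'² + (1 + 1 / (4 z²)) u²`, which is the function `E` of
the proof, is decreasing. -/
theorem besselJ0_sq_add_besselJ1_sq_le {z : ℝ} (hz : 1 ≤ z) :
    besselJ0 z ^ 2 + besselJ1 z ^ 2 ≤ 7 / z := by
  let E : ℝ → ℝ := fun z =>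
    z * (besselJ0 z ^ 2 + besselJ1 z ^ 2) - besselJ0 z * besselJ1 z + besselJ0 z ^ 2 / (2 * z)
  have hE : ∀ z : ℝ, 0 < z → HasDerivAt E (-(besselJ0 z ^ 2 / (2 * z ^ 2))) z := by
    intro z hz
    have h0 := hasDerivAt_besselJ0 z
    have h1 := hasDerivAt_besselJ1 z
    refine ((((hasDerivAt_id z).mul ((h0.pow 2).add (h1.pow 2))).sub (h0.mul h1)).add
      ((h0.pow 2).div ((hasDerivAt_id z).const_mul 2) (by simpa using hz.ne'))).congr_deriv ?_
    have := besselJ1_eq z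
    simp [this]
    field_simp
    ring
  have hanti : AntitoneOn E (Ici 1) := by
    refine antitoneOn_of_deriv_nonpos (convex_Ici 1)
      (fun t ht => (hE t (by linarith [mem_Ici.1 ht])).continuousAt.continuousWithinAt) ?_ ?_
    · intro t ht
      rw [interior_Ici] at ht
      exact (hE t (by linarith [mem_Ioi.1 ht])).differentiableAt.differentiableWithinAt
    · intro t ht
      rw [interior_Ici] at ht
      rw [(hE t (by linarith [mem_Ioi.1 ht])).deriv]
      exact neg_nonpos.2 (by positivity)
  have h := hanti (mem_Ici.2 le_rfl) (mem_Ici.2 hz) hz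
  simp only [E] at h
  have a0 := abs_le.1 (abs_besselJ0_le_one 1)
  have a1 := abs_le.1 (abs_besselJ1_le_one 1)
  have h7 : 0 ≤ besselJ0 z ^ 2 / (2 * z) := by positivity
  rw [le_div_iff₀ (by linarith)]
  -- The energy at `1` is at most `7 / 2`, and `J₀ J₁` absorbs at most half of `z (J₀² + J₁²)`.
  have s0 : besselJ0 1 ^ 2 ≤ 1 := by nlinarith
  have s1 : besselJ1 1 ^ 2 ≤ 1 := by nlinarith
  have s2 : -(besselJ0 1 * besselJ1 1) ≤ 1 := by nlinarith [sq_nonneg (besselJ0 1 + besselJ1 1)]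
  nlinarith [sq_nonneg (besselJ0 z - besselJ1 z), mul_nonneg (sub_nonneg.2 hz)
    (add_nonneg (sq_nonneg (besselJ0 z)) (sq_nonneg (besselJ1 z)))]

/-- The slowly varying profile `h(z) = e^{-iz} (J₀(z) + i J₁(z)) / 2`, which splits
`J₀(z) = e^{iz} h(z) + e^{-iz} conj (h(z))`. -/
noncomputable def besselProfile (z : ℝ) : ℂ :=
  Complex.exp (-(Complex.I * z)) * ((besselJ0 z : ℂ) + Complex.I * (besselJ1 z : ℂ)) / 2

theorem norm_exp_neg_I_mul (z : ℝ) : ‖Complex.exp (-(Complex.I * z))‖ = 1 := by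
  rw [show -(Complex.I * (z : ℂ)) = ((-z : ℝ) : ℂ) * Complex.I by push_cast; ring]
  exact Complex.norm_exp_ofReal_mul_I _

theorem besselJ0_eq (z : ℝ) :
    (besselJ0 z : ℂ) = Complex.exp (Complex.I * z) * besselProfile z +
      Complex.exp (-(Complex.I * z)) * (starRingEnd ℂ) (besselProfile z) := by
  have h : Complex.exp (Complex.I * z) * Complex.exp (-(Complex.I * z)) = 1 := by
    rw [← Complex.exp_add]; simp
  have hc : (starRingEnd ℂ) (Complex.exp (-(Complex.I * z))) = Complex.exp (Complex.I * z) := by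
    rw [← Complex.exp_conj]; simp
  simp only [besselProfile, map_div₀, map_mul, map_add, hc, Complex.conj_ofReal, Complex.conj_I,
    map_ofNat]
  linear_combination (-(besselJ0 z : ℂ)) * h

/-- The combination `J₀ + i J₁` is chosen so that the leading terms of the derivative cancel:
`h'(z) = -i e^{-iz} J₁(z) / (2 z)` gains a factor `1 / z` over `h`. -/
theorem hasDerivAt_besselProfile (z : ℝ) :
    HasDerivAt besselProfile
      (-(Complex.I * Complex.exp (-(Complex.I * z)) * (besselJ1Div z : ℂ) / 2)) z := by
  have h0 := (hasDerivAt_besselJ0 z).ofReal_comp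
  have h1 := (hasDerivAt_besselJ1 z).ofReal_comp
  have he : HasDerivAt (fun z : ℝ => Complex.exp (-(Complex.I * z)))
      (Complex.exp (-(Complex.I * z)) * (-(Complex.I * 1))) z :=
    (((hasDerivAt_id z).ofReal_comp.const_mul Complex.I).neg).cexp
  refine ((he.mul (h0.add (h1.const_mul Complex.I))).div_const 2).congr_deriv ?_
  simp only [Pi.add_apply]
  push_cast
  linear_combination (-(Complex.exp (-(Complex.I * z)) * (besselJ1 z : ℂ)) / 2) * Complex.I_sq

theorem norm_besselProfile_le_one (z : ℝ) : ‖besselProfile z‖ ≤ 1 := by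
  rw [besselProfile, norm_div, norm_mul, norm_exp_neg_I_mul, one_mul]
  have h : ‖(besselJ0 z : ℂ) + Complex.I * (besselJ1 z : ℂ)‖ ≤ 2 := by
    refine (norm_add_le _ _).trans ?_
    rw [norm_mul, Complex.norm_I, Complex.norm_real, Complex.norm_real, Real.norm_eq_abs,
      Real.norm_eq_abs]
    linarith [abs_besselJ0_le_one z, abs_besselJ1_le_one z]
  simp only [Complex.norm_ofNat]
  linarith

theorem norm_besselProfile_le {z p : ℝ} (hz : 0 < z) (hp0 : 0 ≤ p) (hp : p ≤ 1 / 2) :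
    ‖besselProfile z‖ ≤ 3 * z ^ (-p) := by
  rcases le_total z 1 with h | h
  · have : 1 ≤ z ^ (-p) := Real.one_le_rpow_of_pos_of_le_one_of_nonpos hz h (by linarith)
    linarith [norm_besselProfile_le_one z]
  · have h1 : ‖besselProfile z‖ ≤ 3 * z ^ (-(1 / 2) : ℝ) := by
      rw [besselProfile, norm_div, norm_mul, norm_exp_neg_I_mul, one_mul, Real.rpow_neg hz.le,
        ← Real.sqrt_eq_rpow]
      have e : ‖(besselJ0 z : ℂ) + Complex.I * (besselJ1 z : ℂ)‖
          = √(besselJ0 z ^ 2 + besselJ1 z ^ 2) := by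
        rw [mul_comm, Complex.norm_add_mul_I]
      have h7 : √(besselJ0 z ^ 2 + besselJ1 z ^ 2) ≤ 6 * (√z)⁻¹ := by
        rw [Real.sqrt_le_left (by positivity), mul_pow, inv_pow, Real.sq_sqrt hz.le]
        refine (besselJ0_sq_add_besselJ1_sq_le h).trans ?_
        rw [div_eq_mul_inv]; gcongr; norm_num
      rw [e]; simp only [Complex.norm_ofNat]; linarith
    refine h1.trans ?_
    gcongr

theorem abs_besselJ1Div_le {z : ℝ} (hz : 0 ≤ z) : |besselJ1Div z| ≤ 9 * (1 + z) ^ (-(3 / 2) : ℝ) := by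
  rcases le_total z 1 with h | h
  · have h1 : (1 / 9 : ℝ) ≤ (1 + z) ^ (-(3 / 2) : ℝ) := by
      calc (1 / 9 : ℝ) ≤ (2 : ℝ) ^ (-(2 : ℝ)) := by
            rw [Real.rpow_neg (by norm_num), Real.rpow_two]; norm_num
        _ ≤ 2 ^ (-(3 / 2) : ℝ) := Real.rpow_le_rpow_of_exponent_le (by norm_num) (by norm_num)
        _ ≤ _ := Real.rpow_le_rpow_of_nonpos (by linarith) (by linarith) (by norm_num)
    linarith [abs_besselJ1Div_le_one z]
  · have hz0 : 0 < z := by linarith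
    have h1 : |besselJ1 z| ≤ 3 * (√z)⁻¹ := by
      rw [← Real.sqrt_sq_eq_abs, Real.sqrt_le_left (by positivity), mul_pow, inv_pow,
        Real.sq_sqrt hz0.le]
      have h2 := besselJ0_sq_add_besselJ1_sq_le h
      rw [div_eq_mul_inv] at h2
      have : 0 ≤ z⁻¹ := by positivity
      nlinarith [sq_nonneg (besselJ0 z)]
    rw [besselJ1_eq, abs_mul, abs_of_pos hz0] at h1
    have h2 : |besselJ1Div z| ≤ 3 * z ^ (-(3 / 2) : ℝ) := by
      rw [show (-(3 / 2) : ℝ) = -(1 / 2) - 1 by norm_num, Real.rpow_sub_one hz0.ne',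
        Real.rpow_neg hz0.le, ← Real.sqrt_eq_rpow, ← mul_div_assoc, le_div_iff₀ hz0]
      linarith
    refine h2.trans ?_
    have h3 : z ^ (-(3 / 2) : ℝ) ≤ ((1 + z) / 2) ^ (-(3 / 2) : ℝ) :=
      Real.rpow_le_rpow_of_nonpos (by linarith) (by linarith) (by norm_num)
    have h4 : ((1 + z) / 2) ^ (-(3 / 2) : ℝ) = (1 + z) ^ (-(3 / 2) : ℝ) * 2 ^ (3 / 2 : ℝ) := by
      rw [Real.div_rpow (by linarith) (by norm_num), Real.rpow_neg (by norm_num : (0:ℝ) ≤ 2),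
        div_inv_eq_mul]
    have h5 : (2 : ℝ) ^ (3 / 2 : ℝ) ≤ 3 := by
      rw [show (3 / 2 : ℝ) = 1 + 1 / 2 by norm_num, Real.rpow_add (by norm_num), Real.rpow_one,
        ← Real.sqrt_eq_rpow]
      have : √2 ≤ 3 / 2 := by rw [Real.sqrt_le_left (by norm_num)]; norm_num
      linarith
    have h6 : 0 ≤ (1 + z) ^ (-(3 / 2) : ℝ) := by positivity
    nlinarith

theorem norm_deriv_besselProfile (z : ℝ) : ‖deriv besselProfile z‖ = |besselJ1Div z| / 2 := by
  rw [(hasDerivAt_besselProfile z).deriv, norm_neg, norm_div, norm_mul, norm_mul, Complex.norm_I,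
    norm_exp_neg_I_mul, Complex.norm_real]
  simp

theorem norm_deriv_besselProfile_le {z : ℝ} (hz : 0 ≤ z) :
    ‖deriv besselProfile z‖ ≤ 9 / 2 * (1 + z) ^ (-(3 / 2) : ℝ) := by
  rw [norm_deriv_besselProfile]
  linarith [abs_besselJ1Div_le hz]

theorem mul_norm_deriv_besselProfile_le {z p : ℝ} (hz : 0 < z) (hp0 : 0 ≤ p) (hp : p ≤ 1 / 2) :
    z * ‖deriv besselProfile z‖ ≤ 9 / 2 * z ^ (-p) := by
  have h := norm_deriv_besselProfile_le hz.le
  have h1 : (1 + z) ^ (-(3 / 2) : ℝ) ≤ z ^ (-p - 1) := by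
    rcases le_total z 1 with h | h
    · calc (1 + z) ^ (-(3 / 2) : ℝ) ≤ 1 :=
            Real.rpow_le_one_of_one_le_of_nonpos (by linarith) (by norm_num)
        _ ≤ _ := Real.one_le_rpow_of_pos_of_le_one_of_nonpos hz h (by linarith)
    · calc (1 + z) ^ (-(3 / 2) : ℝ) ≤ z ^ (-(3 / 2) : ℝ) :=
            Real.rpow_le_rpow_of_nonpos hz (by linarith) (by norm_num)
        _ ≤ _ := Real.rpow_le_rpow_of_exponent_le h (by linarith)
  rw [Real.rpow_sub_one hz.ne'] at h1
  calc z * ‖deriv besselProfile z‖ ≤ z * (9 / 2 * (z ^ (-p) / z)) := by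
        gcongr; exact h.trans (by gcongr)
    _ = _ := by field_simp

/-! ### The radial oscillatory integral -/

/-- The function `g`, with derivative `g'`, is bounded and decays like a symbol of order `-1/2` on
the half-line. The decay is stated through all intermediate powers `z^{-p}`, `0 ≤ p ≤ 1/2`. -/
structure IsDecayingProfile (g g' : ℝ → ℂ) : Prop where
  hasDerivAt : ∀ z, HasDerivAt g (g' z) z
  norm_le_one : ∀ z, ‖g z‖ ≤ 1
  rpow_mul_norm_le : ∀ z p : ℝ, 0 ≤ z → 0 ≤ p → p ≤ 1 / 2 → z ^ p * ‖g z‖ ≤ 3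
  rpow_mul_norm_deriv_le : ∀ z p : ℝ, 0 ≤ z → 0 ≤ p → p ≤ 1 / 2 → z ^ p * (z * ‖g' z‖) ≤ 9 / 2
  norm_deriv_le : ∀ z : ℝ, 0 ≤ z → ‖g' z‖ ≤ 9 / 2 * (1 + z) ^ (-(3 / 2) : ℝ)

theorem isDecayingProfile_besselProfile :
    IsDecayingProfile besselProfile (deriv besselProfile) where
  hasDerivAt z := (hasDerivAt_besselProfile z).differentiableAt.hasDerivAt
  norm_le_one := norm_besselProfile_le_one
  rpow_mul_norm_le z p hz hp0 hp := by
    rcases hz.eq_or_lt with rfl | hz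
    · have : (0 : ℝ) ^ p ≤ 1 := Real.zero_rpow_le_one p
      nlinarith [norm_besselProfile_le_one 0, norm_nonneg (besselProfile 0)]
    · calc z ^ p * ‖besselProfile z‖ ≤ z ^ p * (3 * z ^ (-p)) := by
            gcongr; exact norm_besselProfile_le hz hp0 hp
        _ = 3 := by rw [Real.rpow_neg hz.le]; field_simp
  rpow_mul_norm_deriv_le z p hz hp0 hp := by
    rcases hz.eq_or_lt with rfl | hz
    · norm_num
    · calc z ^ p * (z * ‖deriv besselProfile z‖) ≤ z ^ p * (9 / 2 * z ^ (-p)) := by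
            exact mul_le_mul_of_nonneg_left (mul_norm_deriv_besselProfile_le hz hp0 hp)
              (by positivity)
        _ = 9 / 2 := by rw [Real.rpow_neg hz.le]; field_simp
  norm_deriv_le z hz := norm_deriv_besselProfile_le hz

theorem IsDecayingProfile.conj {g g' : ℝ → ℂ} (h : IsDecayingProfile g g') :
    IsDecayingProfile (fun z => (starRingEnd ℂ) (g z)) (fun z => (starRingEnd ℂ) (g' z)) where
  hasDerivAt z := (h.hasDerivAt z).star
  norm_le_one z := by simpa using h.norm_le_one z
  rpow_mul_norm_le z p := by simpa using h.rpow_mul_norm_le z p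
  rpow_mul_norm_deriv_le z p := by simpa using h.rpow_mul_norm_deriv_le z p
  norm_deriv_le z := by simpa using h.norm_deriv_le z

/-- Beyond the stationary point only the bounded variation of the profile is used. -/
theorem IsDecayingProfile.norm_integral_tail_le {g g' : ℝ → ℂ} (h : IsDecayingProfile g g')
    {β a s r R : ℝ} (hβ0 : 0 ≤ β) (hβ1 : β ≤ 1) (hs : 0 ≤ s) (hr : 1 ≤ r) (ha : |a| ≤ r ^ 2)
    (hrR : r ≤ R) :
    ‖∫ t in r..R, ((t ^ (1 + β) : ℝ) : ℂ) * cubicExp a t * g (s * t)‖ ≤ 30 := by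
  have hg : Continuous g :=
    continuous_iff_continuousAt.2 fun z => (h.hasDerivAt z).continuousAt
  have hM' : ∀ t ∈ Icc r R, HasDerivAt (fun t : ℝ => -9 * (1 + s * t) ^ (-(1 / 2) : ℝ))
      (9 / 2 * (1 + s * t) ^ (-(3 / 2) : ℝ) * s) t := by
    intro t ht
    have hst : 0 ≤ s * t := mul_nonneg hs (by linarith [ht.1])
    have h1 : HasDerivAt (fun t : ℝ => 1 + s * t) s t := by
      simpa using! ((hasDerivAt_id t).const_mul s).const_add 1
    refine ((h1.rpow_const (p := -(1 / 2)) (Or.inl (by linarith))).const_mul (-9)).congr_deriv ?_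
    rw [show (-(1 / 2) - 1 : ℝ) = -(3 / 2) by norm_num]; ring
  have hm' : ∀ t, HasDerivAt (fun t : ℝ => g (s * t)) ((s : ℂ) * g' (s * t)) t := by
    intro t
    have := HasDerivAt.scomp (h := fun t : ℝ => s * t) (h' := s) t (h.hasDerivAt (s * t))
      (by simpa using! (hasDerivAt_id t).const_mul s)
    simpa using! this
  have hf : ContinuousOn (fun t : ℝ => ((t ^ (1 + β) : ℝ) : ℂ) * cubicExp a t) (Icc r R) := by
    refine ContinuousOn.mul ?_ (by fun_prop)
    refine Complex.continuous_ofReal.comp_continuousOn ?_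
    exact (Real.continuous_rpow_const (by linarith)).continuousOn
  refine (norm_integral_mul_le (B := 3) hrR hf
    (fun z hz => norm_integral_rpow_mul_cubicExp_tail hβ0 hβ1 hr ha le_rfl hz.1)
    (by fun_prop) (fun t _ => hm' t)
    (fun t ht => (hM' t ht).continuousAt.continuousWithinAt)
    (fun t ht => hM' t (Ioo_subset_Icc_self ht)) ?_).trans ?_
  · intro t ht
    have hst : 0 ≤ s * t := mul_nonneg hs (by linarith [ht.1])
    rw [norm_mul, Complex.norm_real, Real.norm_eq_abs, abs_of_nonneg hs, mul_comm]
    exact mul_le_mul_of_nonneg_right (h.norm_deriv_le _ hst) hs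
  · have h1 := h.norm_le_one (s * R)
    have h2 : (1 + s * r) ^ (-(1 / 2) : ℝ) ≤ 1 :=
      Real.rpow_le_one_of_one_le_of_nonpos
        (by linarith [mul_nonneg hs (by linarith : 0 ≤ r)]) (by norm_num)
    have h3 : 0 ≤ (1 + s * R) ^ (-(1 / 2) : ℝ) :=
      Real.rpow_nonneg (by linarith [mul_nonneg hs (by linarith : 0 ≤ R)]) _
    linarith

/-- Up to the stationary point, `t^{1+β} g(st)` is `√t` times `t^{1/2+β} g(st)`, whose supremum and
variation on `[0, R]` are at most a constant times `s^{-p} R^{1/2+β-p}`. -/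
theorem IsDecayingProfile.rpow_mul_norm_integral_le {g g' : ℝ → ℂ} (h : IsDecayingProfile g g')
    {β a s p R : ℝ} (hβ0 : 0 ≤ β) (hβ1 : β ≤ 1) (hs : 0 ≤ s) (hp0 : 0 ≤ p)
    (hp : 3 * p ≤ 1 / 2 + β) (hR : 0 < R) :
    s ^ p * ‖∫ t in (0 : ℝ)..R, ((t ^ (1 + β) : ℝ) : ℂ) * cubicExp a t * g (s * t)‖
      ≤ 240 * R ^ (1 / 2 + β - p) := by
  have hg : Continuous g :=
    continuous_iff_continuousAt.2 fun z => (h.hasDerivAt z).continuousAt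
  set q := 1 / 2 + β with hq
  have hqp : 0 < q - p := by linarith
  have hm' : ∀ t ∈ Ioo 0 R, HasDerivAt (fun t : ℝ => ((s ^ p * t ^ q : ℝ) : ℂ) * g (s * t))
      (((s ^ p * (q * t ^ (q - 1)) : ℝ) : ℂ) * g (s * t) +
        ((s ^ p * t ^ q : ℝ) : ℂ) * ((s : ℂ) * g' (s * t))) t := by
    intro t ht
    have h1 := HasDerivAt.scomp (h := fun t : ℝ => s * t) (h' := s) t (h.hasDerivAt (s * t))
      (by simpa using! (hasDerivAt_id t).const_mul s)
    have h2 := ((Real.hasDerivAt_rpow_const (x := t) (p := q)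
      (Or.inl ht.1.ne')).const_mul (s ^ p)).ofReal_comp
    simpa using! h2.mul h1
  have hM' : ∀ t ∈ Ioo 0 R, HasDerivAt (fun t : ℝ => 9 / (q - p) * t ^ (q - p))
      (9 * t ^ (q - p - 1)) t := by
    intro t ht
    refine ((Real.hasDerivAt_rpow_const (x := t) (p := q - p)
      (Or.inl ht.1.ne')).const_mul (9 / (q - p))).congr_deriv ?_
    field_simp
  have hpow : ∀ t ∈ Ioc 0 R, s ^ p * t ^ q = (s * t) ^ p * t ^ (q - p) := by
    intro t ht
    rw [Real.mul_rpow hs ht.1.le, mul_assoc, ← Real.rpow_add ht.1]; congr 2; ring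
  have key := norm_integral_mul_le (f := fun t => ((√t : ℝ) : ℂ) * cubicExp a t)
    (m := fun t : ℝ => ((s ^ p * t ^ q : ℝ) : ℂ) * g (s * t)) (B := 8) hR.le
    (by fun_prop) (fun z hz => norm_integral_sqrt_mul_cubicExp_le le_rfl hz.1) ?_ hm'
    (M := fun t : ℝ => 9 / (q - p) * t ^ (q - p))
    ((Real.continuous_rpow_const hqp.le).const_mul _).continuousOn hM' ?_
  · have e : s ^ p * ‖∫ t in (0 : ℝ)..R, ((t ^ (1 + β) : ℝ) : ℂ) * cubicExp a t * g (s * t)‖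
        = ‖∫ t in (0 : ℝ)..R, (((√t : ℝ) : ℂ) * cubicExp a t) *
            (((s ^ p * t ^ q : ℝ) : ℂ) * g (s * t))‖ := by
      have hn : s ^ p = ‖((s ^ p : ℝ) : ℂ)‖ := by
        rw [Complex.norm_real, Real.norm_eq_abs, abs_of_nonneg (Real.rpow_nonneg hs p)]
      rw [hn, ← norm_mul, ← intervalIntegral.integral_const_mul, ← hn]
      congr 1
      refine intervalIntegral.integral_congr fun t ht => ?_
      rw [uIcc_of_le hR.le] at ht
      have : t ^ (1 + β) = √t * t ^ q := by
        rw [Real.sqrt_eq_rpow, ← Real.rpow_add_of_nonneg ht.1 (by norm_num) (by linarith)]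
        congr 1; rw [hq]; ring
      simp only [this]
      push_cast; ring
    rw [e]
    refine key.trans ?_
    have h1 : ‖((s ^ p * R ^ q : ℝ) : ℂ) * g (s * R)‖ ≤ 3 * R ^ (q - p) := by
      rw [norm_mul, Complex.norm_real, Real.norm_eq_abs, abs_of_nonneg (by positivity),
        hpow R ⟨hR, le_rfl⟩]
      have := h.rpow_mul_norm_le (s * R) p (by positivity) hp0 (by linarith)
      calc _ = ((s * R) ^ p * ‖g (s * R)‖) * R ^ (q - p) := by ring
        _ ≤ _ := by gcongr
    have h2 : 9 / (q - p) ≤ 27 := by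
      rw [div_le_iff₀ hqp]; linarith
    have h3 : 9 / (q - p) * R ^ (q - p) ≤ 27 * R ^ (q - p) := by gcongr
    rw [Real.zero_rpow hqp.ne']
    linarith
  · refine ContinuousOn.mul (Complex.continuous_ofReal.comp_continuousOn ?_) (by fun_prop)
    exact ((Real.continuous_rpow_const (by linarith)).const_mul _).continuousOn
  · intro t ht
    have ht0 := ht.1
    have hst : 0 ≤ s * t := by positivity
    have h1 := h.rpow_mul_norm_le (s * t) p hst hp0 (by linarith)
    have h2 := h.rpow_mul_norm_deriv_le (s * t) p hst hp0 (by linarith)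
    have e1 : s ^ p * t ^ (q - 1) = (s * t) ^ p * t ^ (q - p - 1) := by
      rw [Real.mul_rpow hs ht0.le, mul_assoc, ← Real.rpow_add ht0]; congr 2; ring
    have e2 : s ^ p * t ^ q = (s * t) ^ p * t ^ (q - p - 1) * t := by
      rw [hpow t ⟨ht0, ht.2.le⟩, Real.rpow_sub_one ht0.ne']; field_simp
    refine (norm_add_le _ _).trans ?_
    rw [norm_mul, norm_mul, norm_mul, Complex.norm_real, Complex.norm_real, Complex.norm_real,
      Real.norm_eq_abs, Real.norm_eq_abs, Real.norm_eq_abs, abs_of_nonneg hs,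
      abs_of_nonneg (by positivity), abs_of_nonneg (by positivity)]
    calc s ^ p * (q * t ^ (q - 1)) * ‖g (s * t)‖ + s ^ p * t ^ q * (s * ‖g' (s * t)‖)
        = (q * ((s * t) ^ p * ‖g (s * t)‖) + (s * t) ^ p * (s * t * ‖g' (s * t)‖)) *
            t ^ (q - p - 1) := by
          rw [e2]; linear_combination (q * ‖g (s * t)‖) * e1
      _ ≤ (3 / 2 * 3 + 9 / 2) * t ^ (q - p - 1) := by
          gcongr; linarith
      _ = _ := by ring

/-- The integral is cut at `√(1 + b + s)`, beyond which there is no stationary point. If `s ≤ 1 + b`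
the decay of the profile is not needed; if `s ≥ 1 + b` the power `p = (1/2 + β) / 3` makes the
contribution bounded. -/
theorem IsDecayingProfile.norm_integral_le {g g' : ℝ → ℂ} (h : IsDecayingProfile g g')
    {β a b s R : ℝ} (hβ0 : 0 ≤ β) (hβ1 : β ≤ 1) (hb : 0 ≤ b) (hs : 0 ≤ s) (ha : |a| ≤ b + s)
    (hR : 0 < R) :
    ‖∫ t in (0 : ℝ)..R, ((t ^ (1 + β) : ℝ) : ℂ) * cubicExp a t * g (s * t)‖
      ≤ 510 * (1 + b) ^ (1 / 4 + β / 2) := by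
  have hg : Continuous g :=
    continuous_iff_continuousAt.2 fun z => (h.hasDerivAt z).continuousAt
  have h1b : 1 ≤ (1 + b) ^ (1 / 4 + β / 2) := Real.one_le_rpow (by linarith) (by linarith)
  have two : ∀ p : ℝ, p ≤ 1 → (2 : ℝ) ^ p ≤ 2 := fun p hp => by
    simpa using Real.rpow_le_rpow_of_exponent_le (by norm_num : (1 : ℝ) ≤ 2) hp
  have main : ∀ R : ℝ, 0 < R → R ≤ √(1 + b + s) →
      ‖∫ t in (0 : ℝ)..R, ((t ^ (1 + β) : ℝ) : ℂ) * cubicExp a t * g (s * t)‖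
        ≤ 480 * (1 + b) ^ (1 / 4 + β / 2) := by
    intro R hR hRr
    have hR2 : ∀ p : ℝ, 0 ≤ p → R ^ (2 * p) ≤ (1 + b + s) ^ p := by
      intro p hp
      rw [Real.rpow_mul hR.le, Real.rpow_two]
      refine Real.rpow_le_rpow (by positivity) ?_ hp
      calc R ^ 2 ≤ √(1 + b + s) ^ 2 := by gcongr
        _ = _ := Real.sq_sqrt (by linarith)
    rcases le_total s (1 + b) with hsb | hsb
    · have h0 := h.rpow_mul_norm_integral_le (a := a) hβ0 hβ1 hs le_rfl (by linarith) hR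
      rw [Real.rpow_zero, one_mul] at h0
      refine h0.trans ?_
      have h1 := hR2 (1 / 4 + β / 2) (by linarith)
      rw [show 2 * (1 / 4 + β / 2) = 1 / 2 + β - 0 by ring] at h1
      have h2 : (1 + b + s) ^ (1 / 4 + β / 2) ≤ 2 * (1 + b) ^ (1 / 4 + β / 2) := by
        calc (1 + b + s) ^ (1 / 4 + β / 2) ≤ (2 * (1 + b)) ^ (1 / 4 + β / 2) :=
              Real.rpow_le_rpow (by linarith) (by linarith) (by linarith)
          _ = 2 ^ (1 / 4 + β / 2) * (1 + b) ^ (1 / 4 + β / 2) :=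
              Real.mul_rpow (by norm_num) (by linarith)
          _ ≤ _ := by gcongr; exact two _ (by linarith)
      linarith
    · have hs1 : 0 < s := by linarith
      -- With this `p` the power `R^{1/2+β-p} = R^{2p}` is at most `(2s)^p`, which cancels `s^{-p}`.
      have h0 := h.rpow_mul_norm_integral_le (a := a) (p := (1 / 2 + β) / 3) hβ0 hβ1 hs
        (by linarith) (by linarith) hR
      have h1 := hR2 ((1 / 2 + β) / 3) (by linarith)
      rw [show 2 * ((1 / 2 + β) / 3) = 1 / 2 + β - (1 / 2 + β) / 3 by ring] at h1
      have h2 : (1 + b + s) ^ ((1 / 2 + β) / 3) ≤ 2 * s ^ ((1 / 2 + β) / 3) := by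
        calc (1 + b + s) ^ ((1 / 2 + β) / 3) ≤ (2 * s) ^ ((1 / 2 + β) / 3) :=
              Real.rpow_le_rpow (by linarith) (by linarith) (by linarith)
          _ = 2 ^ ((1 / 2 + β) / 3) * s ^ ((1 / 2 + β) / 3) :=
              Real.mul_rpow (by norm_num) hs
          _ ≤ _ := by gcongr; exact two _ (by linarith)
      have hsp : 0 < s ^ ((1 / 2 + β) / 3) := by positivity
      have h3 : s ^ ((1 / 2 + β) / 3) *
          ‖∫ t in (0 : ℝ)..R, ((t ^ (1 + β) : ℝ) : ℂ) * cubicExp a t * g (s * t)‖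
          ≤ s ^ ((1 / 2 + β) / 3) * 480 := by linarith
      have h4 := le_of_mul_le_mul_left h3 hsp
      linarith
  have hr1 : 1 ≤ √(1 + b + s) := Real.one_le_sqrt.2 (by linarith)
  rcases le_total R (√(1 + b + s)) with hRr | hRr
  · linarith [main R hR hRr]
  · have hi : ∀ u v : ℝ, IntervalIntegrable
        (fun t : ℝ => ((t ^ (1 + β) : ℝ) : ℂ) * cubicExp a t * g (s * t)) volume u v := by
      intro u v
      apply Continuous.intervalIntegrable
      refine Continuous.mul (Continuous.mul ?_ (by fun_prop)) (by fun_prop)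
      exact Complex.continuous_ofReal.comp (Real.continuous_rpow_const (by linarith))
    rw [← intervalIntegral.integral_add_adjacent_intervals (hi 0 √(1 + b + s)) (hi _ R)]
    refine (norm_add_le _ _).trans ?_
    have h1 := main _ (by linarith) le_rfl
    have h2 := h.norm_integral_tail_le (a := a) hβ0 hβ1 hs hr1
      (by rw [Real.sq_sqrt (by linarith)]; linarith) hRr
    linarith

/-- The radial oscillatory integral, after rescaling the cubic term to `t³`; the bound is uniform in
the cut-off `R` and in the spatial variable `s`. -/
theorem norm_integral_rpow_mul_cubicExp_mul_besselJ0_le {β b s R : ℝ} (hβ0 : 0 ≤ β) (hβ1 : β ≤ 1)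
    (hb : 0 ≤ b) (hs : 0 ≤ s) (hR : 0 < R) :
    ‖∫ t in (0 : ℝ)..R, ((t ^ (1 + β) : ℝ) : ℂ) * cubicExp b t * (besselJ0 (s * t) : ℂ)‖
      ≤ 1020 * (1 + b) ^ (1 / 4 + β / 2) := by
  have hp := isDecayingProfile_besselProfile
  have hi : ∀ {g g' : ℝ → ℂ}, IsDecayingProfile g g' → ∀ a : ℝ, IntervalIntegrable
      (fun t : ℝ => ((t ^ (1 + β) : ℝ) : ℂ) * cubicExp a t * g (s * t)) volume 0 R := by
    intro g g' h a
    have hg : Continuous g :=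
      continuous_iff_continuousAt.2 fun z => (h.hasDerivAt z).continuousAt
    apply Continuous.intervalIntegrable
    refine Continuous.mul (Continuous.mul ?_ (by fun_prop)) (by fun_prop)
    exact Complex.continuous_ofReal.comp (Real.continuous_rpow_const (by linarith))
  have e : ∀ t : ℝ, ((t ^ (1 + β) : ℝ) : ℂ) * cubicExp b t * (besselJ0 (s * t) : ℂ)
      = ((t ^ (1 + β) : ℝ) : ℂ) * cubicExp (b - s) t * besselProfile (s * t) +
        ((t ^ (1 + β) : ℝ) : ℂ) * cubicExp (b + s) t *
          (starRingEnd ℂ) (besselProfile (s * t)) := by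
    intro t
    have e1 : cubicExp (b - s) t
        = cubicExp b t * Complex.exp (Complex.I * ((s * t : ℝ) : ℂ)) := by
      rw [cubicExp, cubicExp, ← Complex.exp_add]; congr 1; push_cast; ring
    have e2 : cubicExp (b + s) t
        = cubicExp b t * Complex.exp (-(Complex.I * ((s * t : ℝ) : ℂ))) := by
      rw [cubicExp, cubicExp, ← Complex.exp_add]; congr 1; push_cast; ring
    rw [besselJ0_eq, e1, e2]; ring
  simp_rw [e]
  rw [intervalIntegral.integral_add (hi hp _) (hi hp.conj _)]
  refine (norm_add_le _ _).trans ?_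
  have h1 := hp.norm_integral_le (a := b - s) hβ0 hβ1 hb hs
    (by rw [abs_le]; constructor <;> linarith) hR
  have h2 := hp.conj.norm_integral_le (a := b + s) hβ0 hβ1 hb hs
    (by rw [abs_of_nonneg (by linarith)]) hR
  linarith

/-! ### Kernels of the truncated multipliers -/

theorem setIntegral_closedBall_eq_polar {k : Plane → ℂ} (hk : Continuous k) {R : ℝ} (hR : 0 ≤ R) :
    ∫ η in Metric.closedBall (0 : Plane) R, k η =
      ∫ r in (0 : ℝ)..R, ∫ ω in (-Real.pi)..Real.pi,
        (r : ℂ) * k !₂[r * Real.cos ω, r * Real.sin ω] := by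
  have hmp : MeasurePreserving (fun p : ℝ × ℝ => (!₂[p.1, p.2] : Plane)) :=
    (PiLp.volume_preserving_toLp (Fin 2)).comp (volume_preserving_finTwoArrow ℝ).symm
  have hemb : MeasurableEmbedding (fun p : ℝ × ℝ => (!₂[p.1, p.2] : Plane)) :=
    ((MeasurableEquiv.toLp 2 (Fin 2 → ℝ)).measurableEmbedding).comp
      (MeasurableEquiv.finTwoArrow (α := ℝ)).symm.measurableEmbedding
  rw [← integral_indicator Metric.isClosed_closedBall.measurableSet,
    ← hmp.integral_comp hemb, ← integral_comp_polarCoord_symm]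
  have hnorm : ∀ p : ℝ × ℝ, 0 < p.1 →
      ‖(!₂[p.1 * Real.cos p.2, p.1 * Real.sin p.2] : Plane)‖ = p.1 := by
    intro p hp
    rw [EuclideanSpace.norm_eq, Fin.sum_univ_two]
    simp only [Real.norm_eq_abs, sq_abs]
    rw [Real.sqrt_eq_iff_eq_sq (by positivity) hp.le]
    simp
    linear_combination (p.1 ^ 2) * Real.cos_sq_add_sin_sq p.2
  have e1 : ∀ p ∈ polarCoord.target,
      p.1 • (Metric.closedBall (0 : Plane) R).indicator k
          !₂[(polarCoord.symm p).1, (polarCoord.symm p).2]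
        = {p : ℝ × ℝ | p.1 ≤ R}.indicator
            (fun p => (p.1 : ℂ) * k !₂[p.1 * Real.cos p.2, p.1 * Real.sin p.2]) p := by
    intro p hp
    have hp0 : 0 < p.1 := hp.1
    simp only [polarCoord_symm_apply]
    by_cases h : p.1 ≤ R
    · rw [indicator_of_mem (by simpa [hnorm p hp0] using h), indicator_of_mem (by exact h)]
      simp
    · rw [indicator_of_notMem (by simpa [hnorm p hp0] using h), indicator_of_notMem (by exact h)]
      simp
  rw [setIntegral_congr_fun polarCoord.open_target.measurableSet e1,
    setIntegral_indicator (measurableSet_le measurable_fst measurable_const)]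
  have e2 : polarCoord.target ∩ {p : ℝ × ℝ | p.1 ≤ R} = Ioc 0 R ×ˢ Ioo (-Real.pi) Real.pi := by
    ext p
    simp only [polarCoord_target, mem_inter_iff, mem_prod, mem_Ioi, mem_Ioo, mem_ofPred_eq, mem_Ioc]
    tauto
  have hc : Continuous fun p : ℝ × ℝ =>
      (p.1 : ℂ) * k !₂[p.1 * Real.cos p.2, p.1 * Real.sin p.2] := by
    refine Continuous.mul (by fun_prop) (hk.comp ?_)
    refine (PiLp.continuous_toLp 2 _).comp ?_
    refine continuous_pi fun i => ?_
    fin_cases i <;> simp <;> fun_prop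
  rw [e2, Measure.volume_eq_prod, setIntegral_prod]
  · rw [intervalIntegral.integral_of_le hR]
    refine setIntegral_congr_fun measurableSet_Ioc fun r _ => ?_
    rw [intervalIntegral.integral_of_le (by linarith [Real.pi_pos]), ← integral_Ioc_eq_integral_Ioo]
  · refine (hc.continuousOn.integrableOn_compact
      (isCompact_Icc.prod isCompact_Icc : IsCompact (Icc 0 R ×ˢ Icc (-Real.pi) Real.pi))).mono_set ?_
    exact prod_mono Ioc_subset_Icc_self Ioo_subset_Icc_self

theorem integral_exp_mul_cos (z : ℝ) :
    ∫ ω in (-Real.pi)..Real.pi, Complex.exp (Complex.I * ((z * Real.cos ω : ℝ) : ℂ))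
      = 2 * Real.pi * (besselJ0 z : ℂ) := by
  have e : ∀ ω : ℝ, Complex.exp (Complex.I * ((z * Real.cos ω : ℝ) : ℂ))
      = ((Real.cos (z * Real.cos ω) : ℝ) : ℂ) +
        ((Real.sin (z * Real.cos ω) : ℝ) : ℂ) * Complex.I := by
    intro ω
    rw [mul_comm Complex.I, Complex.exp_mul_I, Complex.ofReal_cos, Complex.ofReal_sin]
  have hs : ∫ ω in (-Real.pi)..Real.pi, Real.sin (z * Real.cos ω) = 0 := by
    have hper : Function.Periodic (fun ω => Real.sin (z * Real.cos ω)) (2 * Real.pi) := by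
      intro ω; simp
    have h1 := hper.intervalIntegral_add_eq (-Real.pi) 0
    have h2 : ∫ ω in (-Real.pi)..Real.pi, Real.sin (z * Real.cos (ω + Real.pi))
        = ∫ ω in (0 : ℝ)..(0 + 2 * Real.pi), Real.sin (z * Real.cos ω) := by
      rw [intervalIntegral.integral_comp_add_right (fun ω => Real.sin (z * Real.cos ω))]
      congr 1 <;> ring
    rw [show -Real.pi + 2 * Real.pi = Real.pi by ring] at h1
    simp only [Real.cos_add_pi, mul_neg, Real.sin_neg] at h2
    rw [intervalIntegral.integral_neg] at h2
    linarith
  simp_rw [e]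
  rw [intervalIntegral.integral_add
    (by apply Continuous.intervalIntegrable; fun_prop)
    (by apply Continuous.intervalIntegrable; fun_prop), intervalIntegral.integral_mul_const,
    intervalIntegral.integral_ofReal, intervalIntegral.integral_ofReal, hs, besselJ0]
  have : (Real.pi : ℂ) ≠ 0 := Complex.ofReal_ne_zero.2 Real.pi_ne_zero
  push_cast
  field_simp
  ring

/-- The Fourier transform of the arc length of the unit circle. -/
theorem integral_exp_inner_circle (x : Plane) (r : ℝ) :
    ∫ ω in (-Real.pi)..Real.pi, Complex.exp (Complex.I *
        ((r * inner ℝ x (!₂[Real.cos ω, Real.sin ω] : Plane) : ℝ) : ℂ))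
      = 2 * Real.pi * (besselJ0 (r * ‖x‖) : ℂ) := by
  obtain ⟨ω₀, h0, h1⟩ : ∃ ω₀ : ℝ, x 0 = ‖x‖ * Real.cos ω₀ ∧ x 1 = ‖x‖ * Real.sin ω₀ := by
    have hn : ‖(⟨x 0, x 1⟩ : ℂ)‖ = ‖x‖ := by
      rw [EuclideanSpace.norm_eq, Fin.sum_univ_two, Complex.norm_def, Complex.normSq_mk]
      simp only [Real.norm_eq_abs, sq_abs]; ring_nf
    refine ⟨Complex.arg ⟨x 0, x 1⟩, ?_, ?_⟩
    · rw [← hn, Complex.norm_mul_cos_arg]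
    · rw [← hn, Complex.norm_mul_sin_arg]
  have e : ∀ ω : ℝ, r * inner ℝ x (!₂[Real.cos ω, Real.sin ω] : Plane)
      = r * ‖x‖ * Real.cos (ω - ω₀) := by
    intro ω
    rw [PiLp.inner_apply, Fin.sum_univ_two, Real.cos_sub]
    simp [h0, h1]; ring
  simp_rw [e]
  rw [intervalIntegral.integral_comp_sub_right
    (fun ω => Complex.exp (Complex.I * ((r * ‖x‖ * Real.cos ω : ℝ) : ℂ))), ← integral_exp_mul_cos]
  have hper : Function.Periodic
      (fun ω : ℝ => Complex.exp (Complex.I * ((r * ‖x‖ * Real.cos ω : ℝ) : ℂ))) (2 * Real.pi) := by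
    intro ω; simp
  have := hper.intervalIntegral_add_eq (-Real.pi - ω₀) (-Real.pi)
  rw [show -Real.pi - ω₀ + 2 * Real.pi = Real.pi - ω₀ by ring,
    show -Real.pi + 2 * Real.pi = Real.pi by ring] at this
  exact this

/-- The symbol `|ξ|^β e^{i t φ_ε(ξ)}` of `D^β U_ε(t)`. -/
noncomputable def symbol (ε β t : ℝ) (ξ : Plane) : ℂ :=
  ((‖ξ‖ ^ β : ℝ) : ℂ) * Complex.exp (Complex.I * ((t * phase ε ξ : ℝ) : ℂ))

theorem continuous_symbol (ε t : ℝ) {β : ℝ} (hβ : 0 ≤ β) : Continuous (symbol ε β t) := by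
  unfold symbol phase
  refine Continuous.mul (Complex.continuous_ofReal.comp ?_) (by fun_prop)
  exact (Real.continuous_rpow_const hβ).comp continuous_norm

/-- The convolution kernel of `D^β U_ε(t)` with the frequencies `ξ = 2πη`, `|η| > R`, removed. For
`β = 1` these kernels need not converge pointwise as `R → ∞`; only their uniform bound is used. -/
noncomputable def truncatedKernel (ε β t R : ℝ) (x : Plane) : ℂ :=
  ∫ η in Metric.closedBall (0 : Plane) R, symbol ε β t ((2 * Real.pi) • η) *
    Complex.exp (Complex.I * ((2 * Real.pi * inner ℝ x η : ℝ) : ℂ))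

theorem truncatedKernel_eq (ε t : ℝ) {β R : ℝ} (hβ : 0 ≤ β) (hR : 0 ≤ R) (x : Plane) :
    truncatedKernel ε β t R x = ∫ r in (0 : ℝ)..R,
      ((2 * Real.pi * r * (2 * Real.pi * r) ^ β : ℝ) : ℂ) *
        Complex.exp (Complex.I * ((t * (ε * (2 * Real.pi * r) ^ 3 - 2 * Real.pi * r) : ℝ) : ℂ)) *
        (besselJ0 (2 * Real.pi * r * ‖x‖) : ℂ) := by
  have hc := continuous_symbol ε t hβ
  rw [truncatedKernel, setIntegral_closedBall_eq_polar (by fun_prop) hR]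
  refine intervalIntegral.integral_congr fun r hr => ?_
  rw [uIcc_of_le hR] at hr
  have e0 : ∀ ω : ℝ, (!₂[r * Real.cos ω, r * Real.sin ω] : Plane)
      = r • (!₂[Real.cos ω, Real.sin ω] : Plane) := by
    intro ω; ext i; fin_cases i <;> simp
  have e1 : ∀ ω : ℝ, ‖(2 * Real.pi) • (r • (!₂[Real.cos ω, Real.sin ω] : Plane))‖
      = 2 * Real.pi * r := by
    intro ω
    rw [norm_smul, norm_smul, EuclideanSpace.norm_eq, Fin.sum_univ_two]
    have := Real.cos_sq_add_sin_sq ω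
    simp [this, abs_of_nonneg hr.1, abs_of_pos Real.pi_pos]
  have e2 : ∀ ω : ℝ, (r : ℂ) * (symbol ε β t ((2 * Real.pi) • !₂[r * Real.cos ω, r * Real.sin ω]) *
      Complex.exp (Complex.I * ((2 * Real.pi * inner ℝ x
        (!₂[r * Real.cos ω, r * Real.sin ω] : Plane) : ℝ) : ℂ)))
      = ((r * (2 * Real.pi * r) ^ β : ℝ) : ℂ) *
        Complex.exp (Complex.I * ((t * (ε * (2 * Real.pi * r) ^ 3 - 2 * Real.pi * r) : ℝ) : ℂ)) *
        Complex.exp (Complex.I * ((2 * Real.pi * r *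
          inner ℝ x (!₂[Real.cos ω, Real.sin ω] : Plane) : ℝ) : ℂ)) := by
    intro ω
    rw [e0, symbol, phase, e1, inner_smul_right]
    push_cast
    rw [← mul_assoc (2 * (Real.pi : ℂ)) (r : ℂ)]
    ring
  simp_rw [e2]
  rw [intervalIntegral.integral_const_mul, integral_exp_inner_circle]
  push_cast; ring

/-- The frequency is rescaled by `κ = (ε t)^{-1/3}`, which turns `ε t |ξ|³` into `ρ³` and
`t |ξ|` into `t κ ρ`. -/
theorem norm_truncatedKernel_le_of_pos {ε β t R : ℝ} (hε : 0 < ε) (hβ0 : 0 ≤ β) (hβ1 : β ≤ 1)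
    (ht : 0 < t) (hR : 0 < R) (x : Plane) :
    ‖truncatedKernel ε β t R x‖ ≤ 1020 * ((ε * t) ^ (-((2 + β) / 3)) *
      (1 + t * (ε * t) ^ (-(1 / 3) : ℝ)) ^ (1 / 4 + β / 2)) := by
  set κ := (ε * t) ^ (-(1 / 3) : ℝ) with hκ
  have hεt : 0 < ε * t := by positivity
  have hκ0 : 0 < κ := by positivity
  have hκ3 : ε * t * κ ^ 3 = 1 := by
    rw [hκ, ← Real.rpow_natCast, ← Real.rpow_mul hεt.le]
    norm_num
    rw [Real.rpow_neg_one]; field_simp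
  have hκβ : (ε * t) ^ (-((2 + β) / 3)) = κ ^ (2 + β) := by
    rw [hκ, ← Real.rpow_mul hεt.le]; congr 1; ring
  set l := κ / (2 * Real.pi) with hl
  have hl0 : 0 < l := by positivity
  have hlκ : 2 * Real.pi * l = κ := by rw [hl]; field_simp
  rw [truncatedKernel_eq ε t hβ0 hR.le]
  have hsub := intervalIntegral.integral_comp_mul_left (a := 0) (b := R / l) (c := l)
    (fun r => ((2 * Real.pi * r * (2 * Real.pi * r) ^ β : ℝ) : ℂ) *
        Complex.exp (Complex.I * ((t * (ε * (2 * Real.pi * r) ^ 3 - 2 * Real.pi * r) : ℝ) : ℂ)) *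
        (besselJ0 (2 * Real.pi * r * ‖x‖) : ℂ)) hl0.ne'
  rw [mul_zero, mul_div_cancel₀ R hl0.ne', eq_inv_smul_iff₀ hl0.ne'] at hsub
  have e : ∀ ρ ∈ Icc 0 (R / l), ((2 * Real.pi * (l * ρ) * (2 * Real.pi * (l * ρ)) ^ β : ℝ) : ℂ) *
        Complex.exp (Complex.I * ((t * (ε * (2 * Real.pi * (l * ρ)) ^ 3 -
          2 * Real.pi * (l * ρ)) : ℝ) : ℂ)) *
        (besselJ0 (2 * Real.pi * (l * ρ) * ‖x‖) : ℂ)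
      = ((κ ^ (1 + β) : ℝ) : ℂ) * (((ρ ^ (1 + β) : ℝ) : ℂ) * cubicExp (t * κ) ρ *
          (besselJ0 (κ * ‖x‖ * ρ) : ℂ)) := by
    intro ρ hρ
    have h1 : 2 * Real.pi * (l * ρ) = κ * ρ := by rw [← hlκ]; ring
    have h2 : t * (ε * (κ * ρ) ^ 3 - κ * ρ) = ρ ^ 3 - t * κ * ρ := by
      linear_combination ρ ^ 3 * hκ3
    have h3 : κ * ρ * (κ * ρ) ^ β = κ ^ (1 + β) * ρ ^ (1 + β) := by
      rw [← Real.mul_rpow hκ0.le hρ.1, Real.rpow_one_add' (mul_nonneg hκ0.le hρ.1) (by linarith)]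
    rw [h1, h2, h3, cubicExp, show κ * ρ * ‖x‖ = κ * ‖x‖ * ρ by ring]
    push_cast; ring
  have hRl : 0 < R / l := by positivity
  rw [intervalIntegral.integral_congr (fun ρ hρ => e ρ (uIcc_of_le hRl.le ▸ hρ)),
    intervalIntegral.integral_const_mul] at hsub
  rw [← hsub, norm_smul, norm_mul, Complex.norm_real, Real.norm_eq_abs, Real.norm_eq_abs,
    abs_of_pos hl0, abs_of_nonneg (by positivity), hκβ]
  have hmain := norm_integral_rpow_mul_cubicExp_mul_besselJ0_le (b := t * κ) (s := κ * ‖x‖)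
    hβ0 hβ1 (by positivity) (by positivity) hRl
  have hlκ1 : l ≤ κ := by
    rw [hl, div_le_iff₀ (by positivity)]
    nlinarith [Real.pi_gt_three]
  have e3 : κ ^ (2 + β) = κ * κ ^ (1 + β) := by
    rw [show 2 + β = 1 + (1 + β) by ring, Real.rpow_add hκ0, Real.rpow_one]
  rw [e3]
  calc _ ≤ κ * (κ ^ (1 + β) * (1020 * (1 + t * κ) ^ (1 / 4 + β / 2))) := by gcongr
    _ = _ := by ring

/-- Up to complex conjugation the radial integral is unchanged when `t` changes sign. -/
theorem norm_truncatedKernel_neg (ε t : ℝ) {β R : ℝ} (hβ : 0 ≤ β) (hR : 0 ≤ R) (x : Plane) :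
    ‖truncatedKernel ε β (-t) R x‖ = ‖truncatedKernel ε β t R x‖ := by
  rw [truncatedKernel_eq ε t hβ hR, truncatedKernel_eq ε (-t) hβ hR, ← RCLike.norm_conj,
    intervalIntegral.integral_of_le hR, intervalIntegral.integral_of_le hR, ← integral_conj]
  congr 2
  ext r
  rw [map_mul, map_mul, Complex.conj_ofReal, Complex.conj_ofReal, ← Complex.exp_conj, map_mul,
    Complex.conj_I, Complex.conj_ofReal]
  congr 3
  push_cast; ring

theorem norm_truncatedKernel_le {ε β t R : ℝ} (hε : 0 < ε) (hβ0 : 0 ≤ β) (hβ1 : β ≤ 1)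
    (ht : t ≠ 0) (hR : 0 < R) (x : Plane) :
    ‖truncatedKernel ε β t R x‖ ≤ 1020 * ((ε * |t|) ^ (-((2 + β) / 3)) *
      (1 + |t| * (ε * |t|) ^ (-(1 / 3) : ℝ)) ^ (1 / 4 + β / 2)) := by
  rcases ht.lt_or_gt with h | h
  · rw [← norm_truncatedKernel_neg ε t hβ0 hR.le, abs_of_neg h]
    exact norm_truncatedKernel_le_of_pos hε hβ0 hβ1 (by linarith) hR x
  · rw [abs_of_pos h]
    exact norm_truncatedKernel_le_of_pos hε hβ0 hβ1 h hR x

/-! ### Bounded functionals on integrable functions -/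

/-- A bounded functional on `L¹` is integration against a function of `L^∞` with the same bound, on
the products `g f` with `f ∈ L²`, where `g` is a fixed positive weight in `L²`. The weight reduces
the claim to the Riesz representation theorem in `L²`. -/
theorem exists_memLp_top_of_L1_functional {α : Type*} [MeasurableSpace α] {μ : Measure α}
    [SigmaFinite μ] (L : Lp ℂ 1 μ →L[ℂ] ℂ) {M : ℝ} (hM : 0 ≤ M) (hL : ∀ f, ‖L f‖ ≤ M * ‖f‖)
    {g : α → ℝ} (hg : MemLp g 2 μ) (hg0 : ∀ x, 0 < g x) :
    ∃ w : Lp ℂ ∞ μ, ‖w‖ ≤ M ∧ ∀ f : α → ℂ, MemLp f 2 μ →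
      ∀ hgf : MemLp (fun x => (g x : ℂ) * f x) 1 μ,
      L hgf.toLp = ∫ x, (g x * f x) * w x ∂μ := by
  have hgc : MemLp (fun x => (g x : ℂ)) 2 μ := hg.ofReal
  let B := (ContinuousLinearMap.mul ℂ ℂ).holderL μ 2 2 1 hgc.toLp
  let h : Lp ℂ 2 μ := (InnerProductSpace.toDual ℂ (Lp ℂ 2 μ)).symm (L ∘L B)
  have hB : ∀ (f : α → ℂ) (hf : MemLp f 2 μ) (hgf : MemLp (fun x => (g x : ℂ) * f x) 1 μ),
      B hf.toLp = hgf.toLp := by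
    intro f hf hgf
    ext1
    refine (ContinuousLinearMap.coeFn_holder _ _ _).trans ?_
    filter_upwards [hgc.coeFn_toLp, hf.coeFn_toLp, hgf.coeFn_toLp] with x h1 h2 h3
    simp [h1, h2, h3]
  have hprod : ∀ f : α → ℂ, MemLp f 2 μ → MemLp (fun x => (g x : ℂ) * f x) 1 μ :=
    fun f hf => hf.mul' hgc
  have hrep : ∀ (f : α → ℂ) (hf : MemLp f 2 μ) (hgf : MemLp (fun x => (g x : ℂ) * f x) 1 μ),
      L hgf.toLp = ∫ x, f x * (starRingEnd ℂ) (h x) ∂μ := by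
    intro f hf hgf
    have h1 : L (B hf.toLp) = inner ℂ h hf.toLp := by
      simp only [h, InnerProductSpace.toDual_symm_apply]; rfl
    rw [← hB f hf hgf, h1, L2.inner_def]
    refine integral_congr_ae ?_
    filter_upwards [hf.coeFn_toLp] with x hx
    rw [hx, RCLike.inner_apply]
  -- Testing the functional against the phase of `h` bounds `h` by `M * g` in mean.
  have hae : ∀ᵐ x ∂μ, ‖h x‖ ≤ M * g x := by
    refine ae_of_forall_measure_lt_top_ae_restrict _ fun s hs hμs => ?_
    have : IsFiniteMeasure (μ.restrict s) := ⟨by simpa using hμs⟩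
    have hint : ∀ {f : α → ℝ}, MemLp f 2 μ → Integrable f (μ.restrict s) := fun hf =>
      (hf.restrict s).integrable (by norm_num)
    refine ae_le_of_forall_setIntegral_le (hint (Lp.memLp h).norm)
      ((hint hg).const_mul M) fun t ht _ => ?_
    rw [Measure.restrict_restrict ht]
    have hst : MeasurableSet (t ∩ s) := ht.inter hs
    have hμst : μ (t ∩ s) < ∞ := (measure_mono inter_subset_right).trans_lt hμs
    let f : α → ℂ := (t ∩ s).indicator fun x => h x / (‖h x‖ : ℂ)
    have hfm : AEStronglyMeasurable f μ := by
      have := (Lp.aestronglyMeasurable h)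
      exact ((this.aemeasurable.div
        (Complex.measurable_ofReal.comp_aemeasurable this.norm.aemeasurable)).aestronglyMeasurable).indicator
          hst
    have hfb : ∀ x, ‖f x‖ ≤ (t ∩ s).indicator (fun _ => (1 : ℝ)) x := by
      intro x
      by_cases hx : x ∈ t ∩ s
      · simp only [f, indicator_of_mem hx]
        simpa using div_self_le_one ‖h x‖
      · simp [f, indicator_of_notMem hx]
    have hf : MemLp f 2 μ :=
      (memLp_indicator_const 2 hst (1 : ℝ) (Or.inr hμst.ne)).mono hfm
        (Filter.Eventually.of_forall fun x => (hfb x).trans (le_abs_self _))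
    have h1 := hL (hprod f hf).toLp
    have h2 : L (hprod f hf).toLp = ((∫ x in t ∩ s, ‖h x‖ ∂μ : ℝ) : ℂ) := by
      rw [hrep f hf, ← integral_complex_ofReal, ← integral_indicator hst]
      refine integral_congr_ae (Filter.Eventually.of_forall fun x => ?_)
      by_cases hx : x ∈ t ∩ s
      · simp only [f, indicator_of_mem hx]
        by_cases h0 : h x = 0
        · simp [h0]
        · have h0' : (‖h x‖ : ℂ) ≠ 0 := by simpa using h0
          rw [div_mul_eq_mul_div, Complex.mul_conj']
          field_simp
      · simp [f, indicator_of_notMem hx]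
    have h3 : ‖(hprod f hf).toLp‖ ≤ ∫ x in t ∩ s, g x ∂μ := by
      rw [L1.norm_eq_integral_norm, ← integral_indicator hst]
      refine integral_mono_ae (L1.integrable_coeFn _).norm ?_ ?_
      · rw [integrable_indicator_iff hst]
        exact (hint hg).mono_measure (Measure.restrict_mono inter_subset_right le_rfl)
      · filter_upwards [(hprod f hf).coeFn_toLp] with x hx
        rw [hx, norm_mul, Complex.norm_real, Real.norm_eq_abs, abs_of_pos (hg0 x)]
        refine (mul_le_mul_of_nonneg_left (hfb x) (hg0 x).le).trans (le_of_eq ?_)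
        by_cases hx : x ∈ t ∩ s <;> simp [hx]
    rw [integral_const_mul]
    calc ∫ x in t ∩ s, ‖h x‖ ∂μ = ‖L (hprod f hf).toLp‖ := by
          rw [h2, Complex.norm_real, Real.norm_of_nonneg (integral_nonneg fun _ => norm_nonneg _)]
      _ ≤ M * ‖(hprod f hf).toLp‖ := h1
      _ ≤ _ := by gcongr
  let w₀ : α → ℂ := fun x => (starRingEnd ℂ) (h x) / (g x : ℂ)
  have hw₀m : AEStronglyMeasurable w₀ μ := by
    have h1 : AEMeasurable (fun x => (starRingEnd ℂ) (h x)) μ :=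
      (Complex.continuous_conj.comp_aestronglyMeasurable
        (Lp.aestronglyMeasurable h)).aemeasurable
    exact (h1.div hgc.1.aemeasurable).aestronglyMeasurable
  have hw₀b : ∀ᵐ x ∂μ, ‖w₀ x‖ ≤ M := by
    filter_upwards [hae] with x hx
    simp only [w₀, norm_div, RCLike.norm_conj, Complex.norm_real, Real.norm_eq_abs,
      abs_of_pos (hg0 x)]
    rwa [div_le_iff₀ (hg0 x)]
  have hw₀ : MemLp w₀ ∞ μ := memLp_top_of_bound hw₀m M hw₀b
  refine ⟨hw₀.toLp, ?_, fun f hf hgf => ?_⟩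
  · rw [Lp.norm_toLp, eLpNorm_exponent_top]
    exact ENNReal.toReal_le_of_le_ofReal hM (eLpNormEssSup_le_of_ae_bound hw₀b)
  · rw [hrep f hf hgf]
    refine integral_congr_ae ?_
    filter_upwards [hw₀.coeFn_toLp] with x hx
    have : (g x : ℂ) ≠ 0 := by exact_mod_cast (hg0 x).ne'
    rw [hx]
    simp only [w₀]
    field_simp

/-- A functional on Schwartz functions that is bounded for the `L¹` norm is integration against an
essentially bounded function. -/
theorem exists_memLp_top_of_schwartz_functional (l : 𝓢(Plane, ℂ) →ₗ[ℂ] ℂ) {M : ℝ} (hM : 0 ≤ M)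
    (hl : ∀ ψ, ‖l ψ‖ ≤ M * ∫ x, ‖ψ x‖) :
    ∃ w : Lp ℂ ∞ (volume : Measure Plane), ‖w‖ ≤ M ∧ ∀ ψ : 𝓢(Plane, ℂ), l ψ = ∫ x, ψ x * w x := by
  let e : 𝓢(Plane, ℂ) →ₗ[ℂ] Lp ℂ 1 (volume : Measure Plane) :=
    (SchwartzMap.toLpCLM ℂ ℂ 1 volume).toLinearMap
  have hd : DenseRange e := SchwartzMap.denseRange_toLpCLM (F := ℂ) (p := 1) (by norm_num)
  have hn : ∀ ψ, ‖l ψ‖ ≤ M * ‖e ψ‖ := fun ψ => by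
    refine (hl ψ).trans (le_of_eq ?_)
    rw [← SchwartzMap.norm_toLp_one]; rfl
  let g : Plane → ℝ := fun x => (1 + ‖x‖ ^ 2)⁻¹
  have hg0 : ∀ x, 0 < g x := fun x => by positivity
  have hg : MemLp g 2 (volume : Measure Plane) := by
    have hgc : Continuous g := by
      have : ∀ x : Plane, 1 + ‖x‖ ^ 2 ≠ 0 := fun x => by positivity
      fun_prop (disch := assumption)
    rw [memLp_two_iff_integrable_sq hgc.aestronglyMeasurable]
    have := integrable_rpow_neg_one_add_norm_sq (E := Plane) (μ := volume) (r := 4) (by simp; norm_num)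
    refine this.congr (Filter.Eventually.of_forall fun x => ?_)
    simp only [g]
    rw [show (-4 / 2 : ℝ) = -2 by norm_num, Real.rpow_neg (by positivity), Real.rpow_two, inv_pow]
  obtain ⟨w, hw, hrep⟩ := exists_memLp_top_of_L1_functional (l.extendOfNorm e) hM
    (fun f => LinearMap.norm_extendOfNorm_apply_le hd M hn f) hg hg0
  refine ⟨w, hw, fun ψ => ?_⟩
  -- A Schwartz function is `g` times another Schwartz function, since `1 / g` is a polynomial.
  have htg : (fun x : Plane => ((1 + ‖x‖ ^ 2 : ℝ) : ℂ)).HasTemperateGrowth := by fun_prop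
  let f : 𝓢(Plane, ℂ) := SchwartzMap.smulLeftCLM ℂ (fun x : Plane => ((1 + ‖x‖ ^ 2 : ℝ) : ℂ)) ψ
  have hf : ∀ x, (g x : ℂ) * f x = ψ x := by
    intro x
    simp only [f, SchwartzMap.smulLeftCLM_apply_apply htg, g]
    have : ((1 + ‖x‖ ^ 2 : ℝ) : ℂ) ≠ 0 := by exact_mod_cast (by positivity : (1 + ‖x‖ ^ 2 : ℝ) ≠ 0)
    rw [smul_eq_mul, Complex.ofReal_inv]
    field_simp
  have hψ : MemLp (fun x => (g x : ℂ) * f x) 1 (volume : Measure Plane) := by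
    simp_rw [hf]; exact ψ.memLp 1
  have h1 := hrep f (f.memLp 2) hψ
  simp_rw [hf] at h1
  rw [← h1, ← LinearMap.extendOfNorm_eq hd ⟨M, hn⟩ ψ]
  rfl

/-! ### The multiplier on integrable data -/

theorem continuous_fourier_of_integrable {u : Plane → ℂ} (hu : Integrable u) :
    Continuous (𝓕 u : Plane → ℂ) :=
  VectorFourier.fourierIntegral_continuous Real.continuous_fourierChar
    (L := innerₗ Plane) continuous_inner hu

theorem norm_fourier_le_integral_norm (u : Plane → ℂ) (η : Plane) :
    ‖(𝓕 u : Plane → ℂ) η‖ ≤ ∫ x, ‖u x‖ :=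
  VectorFourier.norm_fourierIntegral_le_integral_norm _ _ _ _ _

theorem isFunction_fourier_L1 (u : Lp ℂ 1 (volume : Measure Plane)) :
    IsFunction (𝓕 (Lp.toTemperedDistribution u)) (𝓕 (u : Plane → ℂ)) := by
  have hu : Integrable (u : Plane → ℂ) := L1.integrable_coeFn u
  intro φ
  constructor
  · exact φ.integrable.mul_bdd (continuous_fourier_of_integrable hu).aestronglyMeasurable
      (Filter.Eventually.of_forall (norm_fourier_le_integral_norm u))
  · rw [TemperedDistribution.fourier_apply, Lp.toTemperedDistribution_apply]
    simpa using! VectorFourier.integral_fourierIntegral_smul_eq_flip (L := innerₗ Plane)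
      Real.continuous_fourierChar continuous_inner φ.integrable hu

/-- The truncated multiplier tested against `ψ`, written with its convolution kernel. -/
theorem setIntegral_fourier_mul_eq {s : Plane → ℂ} (hs : Continuous s) {u ψ : Plane → ℂ}
    (hu : Integrable u) (hψ : Integrable ψ) (R : ℝ) :
    ∫ η in Metric.closedBall (0 : Plane) R, (𝓕⁻ ψ : Plane → ℂ) η * (s η * (𝓕 u : Plane → ℂ) η)
      = ∫ p : Plane × Plane, (ψ p.1 * u p.2) *
          ∫ η in Metric.closedBall (0 : Plane) R,
            s η * Complex.exp (Complex.I * ((2 * Real.pi * inner ℝ (p.1 - p.2) η : ℝ) : ℂ)) := by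
  have e1 : ∀ η : Plane, (𝓕⁻ ψ : Plane → ℂ) η * (s η * (𝓕 u : Plane → ℂ) η)
      = ∫ p : Plane × Plane, (ψ p.1 * u p.2) *
          (s η * Complex.exp (Complex.I * ((2 * Real.pi * inner ℝ (p.1 - p.2) η : ℝ) : ℂ))) := by
    intro η
    rw [Real.fourierInv_eq', Real.fourier_eq', mul_left_comm, ← integral_prod_mul,
      ← integral_const_mul]
    refine integral_congr_ae (Filter.Eventually.of_forall fun p => ?_)
    have : Complex.exp (Complex.I * ((2 * Real.pi * inner ℝ (p.1 - p.2) η : ℝ) : ℂ))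
        = Complex.exp (((2 * Real.pi * inner ℝ p.1 η : ℝ) : ℂ) * Complex.I) *
          Complex.exp (((-2 * Real.pi * inner ℝ p.2 η : ℝ) : ℂ) * Complex.I) := by
      rw [← Complex.exp_add, inner_sub_left]; congr 1; push_cast; ring
    simp only [this, smul_eq_mul]
    ring
  simp_rw [e1]
  rw [integral_integral_swap]
  · simp_rw [integral_const_mul]
  · have hsB : Integrable s (volume.restrict (Metric.closedBall (0 : Plane) R)) :=
      hs.continuousOn.integrableOn_compact (isCompact_closedBall _ _)
    have h1 := hsB.mul_prod (hψ.mul_prod hu)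
    have hc : Continuous fun q : Plane × (Plane × Plane) =>
        Complex.exp (Complex.I * ((2 * Real.pi * inner ℝ (q.2.1 - q.2.2) q.1 : ℝ) : ℂ)) := by
      fun_prop
    have h2 := h1.bdd_mul (c := 1) hc.aestronglyMeasurable
      (Filter.Eventually.of_forall fun q => by
        rw [mul_comm, Complex.norm_exp_ofReal_mul_I])
    refine h2.congr (Filter.Eventually.of_forall fun q => ?_)
    simp only [Function.uncurry]
    ring

/-- A uniform bound on the truncated kernels bounds the multiplier from `L¹` to the dual of `L¹`,
whether or not the kernels converge. -/
theorem norm_integral_fourierInv_mul_le {s : Plane → ℂ} (hs : Continuous s) {u ψ : Plane → ℂ}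
    (hu : Integrable u) (hψ : Integrable ψ) {M : ℝ}
    (hM : ∀ R : ℝ, 0 < R → ∀ x : Plane, ‖∫ η in Metric.closedBall (0 : Plane) R,
      s η * Complex.exp (Complex.I * ((2 * Real.pi * inner ℝ x η : ℝ) : ℂ))‖ ≤ M)
    (hi : Integrable fun η => (𝓕⁻ ψ : Plane → ℂ) η * (s η * (𝓕 u : Plane → ℂ) η)) :
    ‖∫ η, (𝓕⁻ ψ : Plane → ℂ) η * (s η * (𝓕 u : Plane → ℂ) η)‖
      ≤ M * (∫ x, ‖u x‖) * ∫ x, ‖ψ x‖ := by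
  have hmono : Monotone fun n : ℕ => Metric.closedBall (0 : Plane) ((n : ℝ) + 1) := by
    intro m n hmn
    exact Metric.closedBall_subset_closedBall (by gcongr)
  have hU : ⋃ n : ℕ, Metric.closedBall (0 : Plane) ((n : ℝ) + 1) = univ := by
    refine eq_univ_of_forall fun x => mem_iUnion.2 ?_
    obtain ⟨n, hn⟩ := exists_nat_ge ‖x‖
    exact ⟨n, by simp; linarith⟩
  have hlim := tendsto_setIntegral_of_monotone (μ := (volume : Measure Plane))
    (fun n : ℕ => (Metric.isClosed_closedBall (x := (0 : Plane)) (ε := (n : ℝ) + 1)).measurableSet)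
    hmono (by rw [hU]; exact hi.integrableOn)
  rw [hU, setIntegral_univ] at hlim
  refine le_of_tendsto hlim.norm (Filter.Eventually.of_forall fun n => ?_)
  rw [setIntegral_fourier_mul_eq hs hu hψ]
  have hb : Integrable fun p : Plane × Plane => M * (‖ψ p.1‖ * ‖u p.2‖) :=
    (hψ.norm.mul_prod hu.norm).const_mul M
  refine (norm_integral_le_of_norm_le hb (Filter.Eventually.of_forall fun p => ?_)).trans ?_
  · rw [norm_mul, norm_mul, mul_comm M]
    exact mul_le_mul_of_nonneg_left (hM _ (by positivity) _) (by positivity)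
  · rw [integral_const_mul, Measure.volume_eq_prod,
      integral_prod_mul (fun x => ‖ψ x‖) (fun x => ‖u x‖)]
    apply le_of_eq; ring

theorem exists_isFunction_fourier_eq {a : Plane → ℂ} (ha : Continuous a) {N : ℝ}
    (hN : ∀ η, ‖a η‖ ≤ N) : ∃ v : 𝓢'(Plane, ℂ), IsFunction (𝓕 v) a := by
  have hm : MemLp a ∞ (volume : Measure Plane) :=
    memLp_top_of_bound ha.aestronglyMeasurable N (Filter.Eventually.of_forall hN)
  refine ⟨𝓕⁻ (Lp.toTemperedDistribution hm.toLp : 𝓢'(Plane, ℂ)), fun φ => ⟨?_, ?_⟩⟩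
  · exact φ.integrable.mul_bdd ha.aestronglyMeasurable (Filter.Eventually.of_forall hN)
  · rw [FourierTransform.fourier_fourierInv_eq, Lp.toTemperedDistribution_apply]
    refine integral_congr_ae ?_
    filter_upwards [hm.coeFn_toLp] with x hx
    rw [hx, smul_eq_mul]

theorem integrable_schwartz_mul_symbol (ε t : ℝ) {β : ℝ} (hβ0 : 0 ≤ β) (hβ1 : β ≤ 1)
    {b : Plane → ℂ} (hb : Continuous b) {N : ℝ} (hN : ∀ η, ‖b η‖ ≤ N) (φ : 𝓢(Plane, ℂ)) :
    Integrable fun η => φ η * (symbol ε β t ((2 * Real.pi) • η) * b η) := by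
  have hs := continuous_symbol ε t hβ0
  have hφ : Integrable fun η : Plane => 7 * (‖φ η‖ + ‖η‖ * ‖φ η‖) := by
    have h1 := φ.integrable_pow_mul (volume : Measure Plane) 1
    simp only [pow_one] at h1
    exact (φ.integrable.norm.add h1).const_mul 7
  refine (hφ.mul_const N).mono' (by fun_prop) (Filter.Eventually.of_forall fun η => ?_)
  have hsb : ‖symbol ε β t ((2 * Real.pi) • η)‖ ≤ 7 * (1 + ‖η‖) := by
    rw [symbol, norm_mul, mul_comm Complex.I, Complex.norm_exp_ofReal_mul_I, mul_one,
      Complex.norm_real, Real.norm_of_nonneg (by positivity), norm_smul,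
      Real.norm_of_nonneg (by positivity)]
    have h2π : 2 * Real.pi ≤ 7 := by linarith [Real.pi_lt_d2]
    have h7 : 2 * Real.pi * ‖η‖ ≤ 7 * ‖η‖ := by gcongr
    have h0 : 0 ≤ 2 * Real.pi * ‖η‖ := by positivity
    rcases le_total (2 * Real.pi * ‖η‖) 1 with h | h
    · have := Real.rpow_le_one h0 h hβ0
      linarith [norm_nonneg η]
    · have := Real.rpow_le_rpow_of_exponent_le h hβ1
      rw [Real.rpow_one] at this
      linarith
  rw [norm_mul, norm_mul]
  calc ‖φ η‖ * (‖symbol ε β t ((2 * Real.pi) • η)‖ * ‖b η‖)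
      ≤ ‖φ η‖ * (7 * (1 + ‖η‖) * N) := by
        gcongr
        exact hN η
    _ = _ := by ring

/-- The two regimes of the dispersive estimate in one formula: the distributions exist, and the norm
is controlled by the rescaled radial integral. -/
theorem exists_dispersive_bound {ε β t : ℝ} (hε : 0 < ε) (hβ0 : 0 ≤ β) (hβ1 : β ≤ 1)
    (ht : t ≠ 0) (u₀ : Lp ℂ 1 (volume : Measure Plane)) :
    ∃ v : 𝓢'(Plane, ℂ), ∃ w : Lp ℂ ∞ (volume : Measure Plane),
      IsPropagated ε t (Lp.toTemperedDistribution u₀) v ∧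
      IsFractionalDerivative β v (Lp.toTemperedDistribution w) ∧
      ‖w‖ ≤ 1020 * ((ε * |t|) ^ (-((2 + β) / 3)) *
        (1 + |t| * (ε * |t|) ^ (-(1 / 3) : ℝ)) ^ (1 / 4 + β / 2)) * ‖u₀‖ := by
  set M := 1020 * ((ε * |t|) ^ (-((2 + β) / 3)) *
    (1 + |t| * (ε * |t|) ^ (-(1 / 3) : ℝ)) ^ (1 / 4 + β / 2)) with hMdef
  have hM0 : 0 ≤ M := (norm_nonneg _).trans
    (norm_truncatedKernel_le hε hβ0 hβ1 ht one_pos (0 : Plane))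
  have hu : Integrable (u₀ : Plane → ℂ) := L1.integrable_coeFn u₀
  have hc := continuous_fourier_of_integrable hu
  have hN := norm_fourier_le_integral_norm (u₀ : Plane → ℂ)
  have hs := continuous_symbol ε t hβ0
  have hint := integrable_schwartz_mul_symbol ε t hβ0 hβ1 hc hN
  let l : 𝓢(Plane, ℂ) →ₗ[ℂ] ℂ :=
    { toFun := fun ψ => ∫ η, (𝓕⁻ ψ : 𝓢(Plane, ℂ)) η *
        (symbol ε β t ((2 * Real.pi) • η) * (𝓕 (u₀ : Plane → ℂ) : Plane → ℂ) η)
      map_add' := fun ψ₁ ψ₂ => by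
        rw [← integral_add (hint _) (hint _)]
        simp [add_mul]
      map_smul' := fun c ψ => by
        rw [RingHom.id_apply, smul_eq_mul, ← integral_const_mul]
        simp [mul_assoc] }
  have hl : ∀ ψ, ‖l ψ‖ ≤ M * ‖u₀‖ * ∫ x, ‖ψ x‖ := by
    intro ψ
    rw [L1.norm_eq_integral_norm]
    have h1 := hint (𝓕⁻ ψ : 𝓢(Plane, ℂ))
    rw [SchwartzMap.fourierInv_coe] at h1
    have h2 := norm_integral_fourierInv_mul_le (s := fun η => symbol ε β t ((2 * Real.pi) • η))
      (by fun_prop) hu ψ.integrable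
      (fun R hR x => norm_truncatedKernel_le hε hβ0 hβ1 ht hR x) h1
    simp only [l, LinearMap.coe_mk, AddHom.coe_mk, SchwartzMap.fourierInv_coe]
    exact h2
  obtain ⟨w, hw, hrep⟩ := exists_memLp_top_of_schwartz_functional l
    (mul_nonneg hM0 (norm_nonneg _)) hl
  have hexp : ∀ η : Plane, ‖Complex.exp (Complex.I *
      ((t * phase ε ((2 * Real.pi) • η) : ℝ) : ℂ))‖ = 1 := fun η => by
    rw [mul_comm, Complex.norm_exp_ofReal_mul_I]
  obtain ⟨v, hv⟩ := exists_isFunction_fourier_eq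
    (a := fun η => Complex.exp (Complex.I * ((t * phase ε ((2 * Real.pi) • η) : ℝ) : ℂ)) *
      (𝓕 (u₀ : Plane → ℂ) : Plane → ℂ) η)
    (by unfold phase; fun_prop) (N := ∫ x, ‖u₀ x‖)
    (fun η => by rw [norm_mul, hexp, one_mul]; exact hN η)
  refine ⟨v, w, ⟨_, isFunction_fourier_L1 u₀, hv⟩, ⟨_, hv, fun φ => ⟨?_, ?_⟩⟩, hw⟩
  · simpa only [symbol, mul_assoc] using hint φ
  · rw [TemperedDistribution.fourier_apply, Lp.toTemperedDistribution_apply]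
    have h1 := hrep (𝓕 φ)
    simp only [smul_eq_mul]
    rw [← h1]
    simp only [l, LinearMap.coe_mk, AddHom.coe_mk, FourierTransform.fourierInv_fourier_eq, symbol,
      mul_assoc]

/-- For `t ≤ θ ε^{1/2}` the rescaled linear coefficient `t (ε t)^{-1/3}` is at most `θ^{2/3}`. -/
theorem short_time_bound {ε β t θ : ℝ} (hε : 0 < ε) (hβ1 : β ≤ 1)
    (ht : 0 < t) (h : t ≤ θ * ε ^ (1 / 2 : ℝ)) :
    (1 + t * (ε * t) ^ (-(1 / 3) : ℝ)) ^ (1 / 4 + β / 2) ≤ 1 + θ ^ (2 / 3 : ℝ) := by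
  have h1 : t * (ε * t) ^ (-(1 / 3) : ℝ) ≤ θ ^ (2 / 3 : ℝ) := by
    have e : t * (ε * t) ^ (-(1 / 3) : ℝ) = (t * ε ^ (-(1 / 2) : ℝ)) ^ (2 / 3 : ℝ) := by
      rw [Real.mul_rpow hε.le ht.le, Real.mul_rpow ht.le (by positivity), ← Real.rpow_mul hε.le]
      rw [mul_left_comm, ← Real.rpow_one_add' ht.le (by norm_num), mul_comm]
      norm_num
    rw [e]
    refine Real.rpow_le_rpow (by positivity) ?_ (by norm_num)
    rw [Real.rpow_neg hε.le, ← div_eq_mul_inv, div_le_iff₀ (by positivity)]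
    exact h
  have h0 : 0 ≤ t * (ε * t) ^ (-(1 / 3) : ℝ) := by positivity
  calc (1 + t * (ε * t) ^ (-(1 / 3) : ℝ)) ^ (1 / 4 + β / 2)
      ≤ (1 + t * (ε * t) ^ (-(1 / 3) : ℝ)) ^ (1 : ℝ) :=
        Real.rpow_le_rpow_of_exponent_le (by linarith) (by linarith)
    _ ≤ _ := by rw [Real.rpow_one]; linarith

/-- For `t ≥ θ ε^{1/2}` the rescaled linear coefficient `t (ε t)^{-1/3}` is at least `θ^{2/3}`, hence
comparable with one plus itself. -/
theorem long_time_bound {ε β t θ : ℝ} (hε : 0 < ε) (hθ : 0 < θ) (hβ0 : 0 ≤ β) (hβ1 : β ≤ 1)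
    (ht : 0 < t) (h : θ * ε ^ (1 / 2 : ℝ) ≤ t) :
    (ε * t) ^ (-((2 + β) / 3)) * (1 + t * (ε * t) ^ (-(1 / 3) : ℝ)) ^ (1 / 4 + β / 2)
      ≤ (1 + θ ^ (-(2 / 3) : ℝ)) * (ε ^ (-(3 / 4) - β / 2) * t ^ (-(1 / 2) : ℝ)) := by
  set b := t * (ε * t) ^ (-(1 / 3) : ℝ) with hb
  have e : b = t ^ (2 / 3 : ℝ) * ε ^ (-(1 / 3) : ℝ) := by
    rw [hb, Real.mul_rpow hε.le ht.le, mul_left_comm, ← Real.rpow_one_add' ht.le (by norm_num),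
      mul_comm]
    norm_num
  have hb0 : 0 < b := by positivity
  have h1 : 1 ≤ θ ^ (-(2 / 3) : ℝ) * b := by
    have : θ ^ (-(2 / 3) : ℝ) * b = (t * ε ^ (-(1 / 2) : ℝ) / θ) ^ (2 / 3 : ℝ) := by
      rw [e, Real.div_rpow (by positivity) hθ.le, Real.mul_rpow ht.le (by positivity),
        ← Real.rpow_mul hε.le, Real.rpow_neg hθ.le, div_eq_inv_mul]
      norm_num
      ring
    rw [this]
    refine Real.one_le_rpow ?_ (by norm_num)
    rw [le_div_iff₀ hθ, one_mul, Real.rpow_neg hε.le, ← div_eq_mul_inv,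
      le_div_iff₀ (by positivity)]
    exact h
  set A := 1 + θ ^ (-(2 / 3) : ℝ) with hA
  have hA1 : 1 ≤ A := by
    have : 0 ≤ θ ^ (-(2 / 3) : ℝ) := by positivity
    linarith
  have h2 : (1 + b) ^ (1 / 4 + β / 2) ≤ A * b ^ (1 / 4 + β / 2) := by
    calc (1 + b) ^ (1 / 4 + β / 2) ≤ (A * b) ^ (1 / 4 + β / 2) :=
          Real.rpow_le_rpow (by positivity) (by rw [hA]; linarith) (by linarith)
      _ = A ^ (1 / 4 + β / 2) * b ^ (1 / 4 + β / 2) := Real.mul_rpow (by linarith) hb0.le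
      _ ≤ A ^ (1 : ℝ) * b ^ (1 / 4 + β / 2) := by
          gcongr
          linarith
      _ = _ := by rw [Real.rpow_one]
  have e2 : (ε * t) ^ (-((2 + β) / 3)) * b ^ (1 / 4 + β / 2)
      = ε ^ (-(3 / 4) - β / 2) * t ^ (-(1 / 2) : ℝ) := by
    rw [e, Real.mul_rpow hε.le ht.le, Real.mul_rpow (by positivity) (by positivity),
      ← Real.rpow_mul ht.le, ← Real.rpow_mul hε.le]
    calc _ = (ε ^ (-((2 + β) / 3)) * ε ^ (-(1 / 3) * (1 / 4 + β / 2))) *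
          (t ^ (-((2 + β) / 3)) * t ^ (2 / 3 * (1 / 4 + β / 2))) := by ring
      _ = _ := by
        rw [← Real.rpow_add hε, ← Real.rpow_add ht]
        congr 2 <;> ring
  calc _ ≤ (ε * t) ^ (-((2 + β) / 3)) * (A * b ^ (1 / 4 + β / 2)) := by gcongr
    _ = A * ((ε * t) ^ (-((2 + β) / 3)) * b ^ (1 / 4 + β / 2)) := by ring
    _ = _ := by rw [e2]

end KdVDispersive

theorem proposition3p5 (θ : ℝ) (hθ : 0 < θ) :
    ∃ C : ℝ, 0 < C ∧
      ∀ ε β t : ℝ, 0 < ε → ε ≤ 1 → 0 ≤ β → β ≤ 1 → t ≠ 0 →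
      ∀ u₀ : Lp ℂ 1 (volume : Measure KdVDispersive.Plane),
      ∃ v : 𝓢'(KdVDispersive.Plane, ℂ),
      ∃ w : Lp ℂ ∞ (volume : Measure KdVDispersive.Plane),
        KdVDispersive.IsPropagated ε t (Lp.toTemperedDistribution u₀) v ∧
        KdVDispersive.IsFractionalDerivative β v (Lp.toTemperedDistribution w) ∧
        (|t| ≤ θ * ε ^ (1 / 2 : ℝ) →
          ‖w‖ ≤ C * (ε * |t|) ^ (-((2 + β) / 3)) * ‖u₀‖) ∧
        (θ * ε ^ (1 / 2 : ℝ) ≤ |t| →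
          ‖w‖ ≤ C * (ε ^ (-(3 / 4) - β / 2) * |t| ^ (-(1 / 2) : ℝ)) * ‖u₀‖) := by
  have hθ1 : 0 < θ ^ (2 / 3 : ℝ) := by positivity
  have hθ2 : 0 < θ ^ (-(2 / 3) : ℝ) := by positivity
  refine ⟨1020 * (1 + θ ^ (2 / 3 : ℝ) + θ ^ (-(2 / 3) : ℝ)), by positivity, ?_⟩
  intro ε β t hε _ hβ0 hβ1 ht u₀
  have ht' : 0 < |t| := abs_pos.2 ht
  obtain ⟨v, w, hv, hw, hbound⟩ := KdVDispersive.exists_dispersive_bound hε hβ0 hβ1 ht u₀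
  refine ⟨v, w, hv, hw, fun h => hbound.trans ?_, fun h => hbound.trans ?_⟩
  · have h1 := KdVDispersive.short_time_bound hε hβ1 ht' h
    have h2 : 0 ≤ (ε * |t|) ^ (-((2 + β) / 3)) := by positivity
    refine mul_le_mul_of_nonneg_right ?_ (norm_nonneg u₀)
    calc 1020 * ((ε * |t|) ^ (-((2 + β) / 3)) *
          (1 + |t| * (ε * |t|) ^ (-(1 / 3) : ℝ)) ^ (1 / 4 + β / 2))
        ≤ 1020 * ((ε * |t|) ^ (-((2 + β) / 3)) * (1 + θ ^ (2 / 3 : ℝ) + θ ^ (-(2 / 3) : ℝ))) := by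
          gcongr; linarith
      _ = _ := by ring
  · have h1 := KdVDispersive.long_time_bound hε hθ hβ0 hβ1 ht' h
    have h2 : 0 ≤ ε ^ (-(3 / 4) - β / 2) * |t| ^ (-(1 / 2) : ℝ) := by positivity
    refine mul_le_mul_of_nonneg_right ?_ (norm_nonneg u₀)
    calc 1020 * ((ε * |t|) ^ (-((2 + β) / 3)) *
          (1 + |t| * (ε * |t|) ^ (-(1 / 3) : ℝ)) ^ (1 / 4 + β / 2))
        ≤ 1020 * ((1 + θ ^ (-(2 / 3) : ℝ)) *
            (ε ^ (-(3 / 4) - β / 2) * |t| ^ (-(1 / 2) : ℝ))) := by gcongr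
      _ ≤ 1020 * ((1 + θ ^ (2 / 3 : ℝ) + θ ^ (-(2 / 3) : ℝ)) *
            (ε ^ (-(3 / 4) - β / 2) * |t| ^ (-(1 / 2) : ℝ))) := by gcongr; linarith
      _ = _ := by ring
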